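/- Let $G$ be a compact (Hausdorff) abelian group with normalized Haar measure $\mu$, and let $\ell\mapsto A^{\ell}$ be a $\mathbb Z^d$-action on $G$ by commuting continuous automorphisms which is mixing of all orders, i.e. for all $r\ge 2$ and all Borel sets $B_1,\dots,B_r\subset G$, $$\mu\Bigl(\bigcap_{i=1}^r A^{-n_i}B_i\Bigr)\to\prod_{i=1}^r\mu(B_i)\quad\text{as }\min_{i\ne j}\|n_i-n_j\|\to\infty .$$ Let $f\in AC_0(G)$, i.e. $f$ is a real function on $G$ with $\int f\,d\mu=0$ and with absolutely convergent Fourier series: $f=\sum_{\chi\in\widehat G}c_f(\chi)\chi$ ($\mu$-a.e.) with $\sum_{\chi}|c_f(\chi)|<\infty$, where $c_f(\chi)=\int\overline\chi f\,d\mu$. Then $f$ has a continuous spectral density $\varphi_f\ge 0$ on $\mathbb T^d=(\mathbb R/\mathbb Z)^d$, that is, $\int_{\mathbb T^d}\varphi_f(t)e^{-2\pi i\langle \ell,t\rangle}dt=\int_G f(A^\ell x)f(x)\,d\mu(x)$ for all $\ell\in\mathbb Z^d$. Let $(z_k)_{k\ge0}$ be a (deterministic) sequence in $\mathbb Z^d$,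 and put $R_n(\ell)=\#\{0\le k<n: z_k=\ell\}$ and $v_n=\#\{0\le k,k'<n: z_k=z_{k'}\}=\sum_\ell R_n(\ell)^2$. Suppose that $(z_k)$ is $\zeta$-regular for a probability measure $\zeta$ on $\mathbb T^d$, i.e. the measures $\widetilde R_n(t)\,dt$ with $\widetilde R_n(t)=v_n^{-1}\bigl|\sum_{\ell}R_n(\ell)e^{2\pi i\langle\ell,t\rangle}\bigr|^2$ converge weakly to $\zeta$, and that $$n\,\Bigl(\sup_{\ell}R_n(\ell)\Bigr)^{r-1}=o\bigl(v_n^{r/2}\bigr)\quad(n\to\infty)\qquad\text{for every integer } r\ge3 .$$ Then, with respect to $\mu$, $$v_n^{-1/2}\sum_{k=0}^{n-1}f(A^{z_k}\,\cdot\,)\ \longrightarrow\ \mathcal N\bigl(0,\zeta(\varphi_f)\bigr)\quad\text{in distribution as } n\to\infty,\qquad \zeta(\varphi_f)=\int_{\mathbb T^d}\varphi_f\,d\zeta,$$ where $\mathcal N(0,0)$ means $\delta_0$. -/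

import Mathlib

open MeasureTheory ProbabilityTheory Filter Topology Asymptotics

noncomputable section

namespace AlgActionCLT

/-- A `ℤ^d`-action `ℓ ↦ A^ℓ` on `G` by (commuting) continuous group automorphisms. -/
structure AutAction (d : ℕ) (G : Type*) [CommGroup G] [TopologicalSpace G] where
  /-- The automorphism `A^ℓ`. -/
  toFun : (Fin d → ℤ) → (G ≃ₜ* G)
  map_zero : ∀ x, toFun 0 x = x
  map_add : ∀ l m x, toFun (l + m) x = toFun l (toFun m x)

instance (d : ℕ) (G : Type*) [CommGroup G] [TopologicalSpace G] :
    CoeFun (AutAction d G) (fun _ => (Fin d → ℤ) → (G ≃ₜ* G)) :=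
  ⟨AutAction.toFun⟩

section Group

variable {d : ℕ} {G : Type*} [CommGroup G] [TopologicalSpace G] [MeasurableSpace G]

/-- Mixing of order `r`: `μ(⋂ A^{-n_i} B_i) → ∏ μ(B_i)` for all measurable `B_1, …, B_r`, when
`min_{i ≠ j} ‖n_i - n_j‖ → ∞`. -/
def IsMixingOfOrder (A : AutAction d G) (μ : Measure G) (r : ℕ) : Prop :=
  ∀ B : Fin r → Set G, (∀ i, MeasurableSet (B i)) →
    ∀ ε : ℝ, 0 < ε → ∃ M : ℝ, ∀ n : Fin r → Fin d → ℤ,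
      (∀ i j, i ≠ j → M ≤ ‖n i - n j‖) →
        |μ.real (⋂ i, (A (n i)) ⁻¹' (B i)) - ∏ i, μ.real (B i)| < ε

/-- Mixing of all orders. -/
def IsMixingOfAllOrders (A : AutAction d G) (μ : Measure G) : Prop :=
  ∀ r : ℕ, 2 ≤ r → IsMixingOfOrder A μ r

/-- The Fourier coefficient `c_f(χ) = ∫ conj χ · f dμ` of `f` at the character `χ` of `G`. -/
def fourierCoefficient (μ : Measure G) (f : G → ℝ) (χ : PontryaginDual G) : ℂ :=
  ∫ x, (starRingEnd ℂ) (χ x : ℂ) * (f x : ℂ) ∂μ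

/-- The class `AC_0(G)` of real functions on `G` with zero mean and with absolutely convergent
Fourier series, `f = ∑ c_f(χ) χ` (almost everywhere) with `∑ |c_f(χ)| < ∞`. -/
structure IsAC0 (μ : Measure G) (f : G → ℝ) : Prop where
  integrable : Integrable f μ
  integral_eq_zero : ∫ x, f x ∂μ = 0
  summable : Summable fun χ : PontryaginDual G => ‖fourierCoefficient μ f χ‖
  hasSum : ∀ᵐ x ∂μ, HasSum
    (fun χ : PontryaginDual G => fourierCoefficient μ f χ * (χ x : ℂ)) (f x : ℂ)

/-- `ν` is the spectral measure of the real function `f`: the finite positive measure on `𝕋^d`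
with Fourier coefficients `ν̂(ℓ) = ⟨A^ℓ f, f⟩`, where `A^ℓ f = f ∘ A^ℓ`. -/
structure IsSpectralMeasure (A : AutAction d G) (μ : Measure G) (f : G → ℝ)
    (ν : Measure (UnitAddTorus (Fin d))) : Prop where
  finite : IsFiniteMeasure ν
  coeff : ∀ l : Fin d → ℤ,
    ∫ t, UnitAddTorus.mFourier (-l) t ∂ν = ((∫ x, f (A l x) * f x ∂μ : ℝ) : ℂ)

end Group

/-- The Haar (Lebesgue) probability measure on `𝕋^d = (ℝ/ℤ)^d`. -/
def torusHaar (d : ℕ) : Measure (UnitAddTorus (Fin d)) :=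
  Measure.pi fun _ => AddCircle.haarAddCircle

/-- `φ` is a (nonnegative, continuous) spectral density of `f`: the spectral measure of `f` is
`φ(t) dt`. -/
def IsSpectralDensity {d : ℕ} {G : Type*} [CommGroup G] [TopologicalSpace G] [MeasurableSpace G]
    (A : AutAction d G) (μ : Measure G) (f : G → ℝ) (φ : C(UnitAddTorus (Fin d), ℝ)) : Prop :=
  (∀ t, 0 ≤ φ t) ∧
    IsSpectralMeasure A μ f ((torusHaar d).withDensity fun t => ENNReal.ofReal (φ t))

section Summation

variable {d : ℕ}

/-- The normalized kernel
`R̃(t) = |∑_ℓ R(ℓ) e^{2πi⟨ℓ,t⟩}|² / ∑_ℓ R(ℓ)²` of a summable weight `R` on `ℤ^d`. -/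
def normalizedKernel (R : (Fin d → ℤ) → ℝ) (t : UnitAddTorus (Fin d)) : ℝ :=
  ‖∑' l, (R l : ℂ) * UnitAddTorus.mFourier l t‖ ^ 2 / ∑' l, R l ^ 2

/-- `ζ`-regularity of a summation sequence `(R_n)`: the measures `R̃_n(t) dt` converge weakly
to `ζ`. -/
def IsZetaRegular (R : ℕ → (Fin d → ℤ) → ℝ) (ζ : Measure (UnitAddTorus (Fin d))) : Prop :=
  ∀ φ : C(UnitAddTorus (Fin d), ℝ),
    Tendsto (fun n => ∫ t, normalizedKernel (R n) t * φ t ∂(torusHaar d)) atTop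
      (𝓝 (∫ t, φ t ∂ζ))

/-- The local time `#{0 ≤ k < n : z_k = ℓ}`. -/
def localTime (z : ℕ → Fin d → ℤ) (n : ℕ) (l : Fin d → ℤ) : ℕ :=
  ((Finset.range n).filter fun k => z k = l).card

/-- The maximal local time `sup_ℓ #{0 ≤ k < n : z_k = ℓ}` (a supremum of numbers at most `n`). -/
def maxLocalTime (z : ℕ → Fin d → ℤ) (n : ℕ) : ℕ :=
  ⨆ l, localTime z n l

/-- The number of self-intersections `v_n = #{0 ≤ k', k < n : z_k = z_{k'}}`. -/
def selfIntersections (z : ℕ → Fin d → ℤ) (n : ℕ) : ℕ :=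
  ((Finset.range n ×ˢ Finset.range n).filter fun p => z p.1 = z p.2).card

/-- The sequential summation sequence `R_n(ℓ) = ∑_{k<n} 1_{z_k = ℓ}` defined by `z`. -/
def sequentialSummation (z : ℕ → Fin d → ℤ) (n : ℕ) (l : Fin d → ℤ) : ℝ :=
  localTime z n l

end Summation

end AlgActionCLT

end

/-! The proof is the method of moments for trigonometric polynomials, followed by an approximation
in `L²` that is uniform in `n`.

Let `f` be a finite combination of nontrivial characters. By orthogonality, the `r`-th moment of
`∑_{k<n} f ∘ A^{z_k}` is a weighted count of `r`-tuples of translated characters with product `1`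
(`integral_birkhoff_pow`). Mixing of all orders passes to the dual group: well separated translates
of characters, not all trivial, never multiply to `1` (`IsMixingOfAllOrders.isMixing_dual`). Hence
every factor of a trivial product lies in a trivial subproduct whose lattice points are within a
bounded distance (`exists_near_subproduct`). A block of size `b` costs a factor `O(∑_k N_k^(b-1))`,
where `N_k` is the number of times at which `z` is near `z_k`. This is `O(v_n)` for `b = 2`, and
`o(v_n^(b/2))` for `b ≥ 3` by the growth hypothesis. So, up to `o(v_n^(r/2))`, the first factor is
inverse to exactly one other factor (`isLittleO_irregularTuples`). Removing that pair gives `m_{r+2}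
≈ (r+1) m_2 m_r`, the recursion of Gaussian moments (`norm_momentSum_sub_le`, `tendsto_momentSum`).
The variance converges because `∫ S_n² dμ / v_n` equals the integral of the spectral density against
the normalized kernel, and `z` is `ζ`-regular.

For general `f`, mixing makes stabilizers of nontrivial characters trivial, so two given characters
correlate for at most one lattice point. Therefore the correlations of `f` have sum at most
`‖c_f‖₁²` in absolute value. This produces the continuous spectral density as an absolutely
convergent Fourier series, and it gives `∫ S_n² dμ ≤ v_n ‖c_f‖₁²` (`integral_birkhoff_sq_le`), so
that truncating the Fourier series changes the normalized sums by a small amount in `L²`, uniformly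
in `n`. Characteristic functions and limiting variances then pass to the limit (`tendsto_charFun`).
-/

set_option linter.unusedSectionVars false

noncomputable section

namespace AlgActionCLT

/-! ### Algebraic mixing and localization of trivial products -/

/-- An action of `ℤ^d` on a commutative group by commuting endomorphisms. -/
structure EndAction (d : ℕ) (Γ : Type*) [CommGroup Γ] where
  /-- The endomorphism attached to a lattice point. -/
  toFun : (Fin d → ℤ) → Γ →* Γ
  map_zero : ∀ χ, toFun 0 χ = χ
  map_add : ∀ l m χ, toFun (l + m) χ = toFun l (toFun m χ)

namespace EndAction

instance (d : ℕ) (Γ : Type*) [CommGroup Γ] :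
    CoeFun (EndAction d Γ) (fun _ => (Fin d → ℤ) → Γ →* Γ) := ⟨EndAction.toFun⟩

variable {d : ℕ} {Γ : Type*} [CommGroup Γ] (T : EndAction d Γ)

/-- Products of well separated translates of elements which are not all trivial are nontrivial. -/
def IsMixing : Prop :=
  ∀ (r : ℕ), 2 ≤ r → ∀ χ : Fin r → Γ, (∃ i, χ i ≠ 1) → ∃ M : ℝ, ∀ n : Fin r → Fin d → ℤ,
    (∀ i j, i ≠ j → M ≤ ‖n i - n j‖) → ∏ i, T (n i) (χ i) ≠ 1

variable {T}

theorem injective (l : Fin d → ℤ) : Function.Injective (T l) := by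
  intro χ χ' h
  have := congrArg (T (-l)) h
  rwa [← T.map_add, ← T.map_add, neg_add_cancel, T.map_zero, T.map_zero] at this

theorem apply_eq_one_iff (l : Fin d → ℤ) (χ : Γ) : T l χ = 1 ↔ χ = 1 :=
  map_eq_one_iff (T l) (injective l)

theorem nsmul_apply_eq {l : Fin d → ℤ} {χ : Γ} (h : T l χ = χ) (k : ℕ) : T (k • l) χ = χ := by
  induction k with
  | zero => rw [zero_smul, T.map_zero]
  | succ k ih => rw [succ_nsmul, T.map_add, h, ih]

/-- All multiples `k • l` fix `χ` too, so if `l ≠ 0` the pair `χ`, `χ⁻¹` placed at the distant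
points `k • l` and `0` has trivial product, against mixing of order two. -/
theorem IsMixing.eq_zero_of_apply_eq (hT : T.IsMixing) {χ : Γ} (hχ : χ ≠ 1) {l : Fin d → ℤ}
    (h : T l χ = χ) : l = 0 := by
  by_contra hl
  obtain ⟨M, hM⟩ := hT 2 le_rfl ![χ, χ⁻¹] ⟨0, hχ⟩
  obtain ⟨k, hk⟩ := exists_nat_ge M
  have hl1 : (1 : ℝ) ≤ ‖l‖ := by
    obtain ⟨i, hi⟩ := Function.ne_iff.mp hl
    refine le_trans ?_ (norm_le_pi_norm l i)
    rw [Int.norm_eq_abs]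
    exact_mod_cast Int.one_le_abs hi
  have hkl : M ≤ ‖k • l‖ := by
    have : ‖k • l‖ = k * ‖l‖ := by
      rw [← natCast_zsmul, norm_smul, Int.norm_natCast]
    rw [this]
    nlinarith [Nat.cast_nonneg (α := ℝ) k]
  refine hM ![k • l, 0] ?_ ?_
  · intro i j hij
    fin_cases i <;> fin_cases j <;> simp_all
  · simp only [Fin.prod_univ_two, Matrix.cons_val_zero, Matrix.cons_val_one]
    rw [nsmul_apply_eq h, T.map_zero, mul_inv_cancel]

theorem IsMixing.eq_of_apply_eq (hT : T.IsMixing) {χ : Γ} (hχ : χ ≠ 1) {l m : Fin d → ℤ}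
    (h : T l χ = T m χ) : l = m := by
  have : T (-m + l) χ = χ := by
    rw [T.map_add, h, ← T.map_add, neg_add_cancel, T.map_zero]
  have := hT.eq_zero_of_apply_eq hχ this
  rwa [neg_add_eq_zero, eq_comm] at this

theorem IsMixing.exists_uniform (hT : T.IsMixing) {r : ℕ} (hr : 2 ≤ r) (F : Finset Γ) :
    ∃ M : ℝ, ∀ χ : Fin r → Γ, (∀ i, χ i ∈ F) → (∃ i, χ i ≠ 1) → ∀ n : Fin r → Fin d → ℤ,
      (∀ i j, i ≠ j → M ≤ ‖n i - n j‖) → ∏ i, T (n i) (χ i) ≠ 1 := by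
  classical
  have h : ∀ χ : Fin r → Γ, ∃ M : ℝ, (∃ i, χ i ≠ 1) → ∀ n : Fin r → Fin d → ℤ,
      (∀ i j, i ≠ j → M ≤ ‖n i - n j‖) → ∏ i, T (n i) (χ i) ≠ 1 := by
    intro χ
    by_cases hχ : ∃ i, χ i ≠ 1
    · obtain ⟨M, hM⟩ := hT r hr χ hχ
      exact ⟨M, fun _ => hM⟩
    · exact ⟨0, fun h => absurd h hχ⟩
  choose M hM using h
  obtain ⟨K, hK⟩ := ((Fintype.piFinset fun _ : Fin r => F).image M).exists_le
  refine ⟨K, fun χ hχ h1 n hn => hM χ h1 n fun i j hij => (hK _ ?_).trans (hn i j hij)⟩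
  exact Finset.mem_image_of_mem _ (by simpa using hχ)

/-- If a product of translates of elements of a finite set is trivial, then every factor belongs to
a subproduct which is trivial and whose translation parameters are at a bounded distance. -/
theorem IsMixing.exists_near_subproduct (hT : T.IsMixing) (s : ℕ) (F : Finset Γ) :
    ∃ M : ℝ, 0 ≤ M ∧ ∀ (ι : Type) (S : Finset ι) (χ : ι → Γ) (l : ι → Fin d → ℤ) (i₀ : ι),
      i₀ ∈ S → S.card = s → (∀ i ∈ S, χ i ∈ F) → ∏ i ∈ S, T (l i) (χ i) = 1 →
        ∃ B ⊆ S, i₀ ∈ B ∧ ∏ i ∈ B, T (l i) (χ i) = 1 ∧ ∀ i ∈ B, ‖l i - l i₀‖ ≤ M := by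
  classical
  induction s generalizing F with
  | zero =>
    refine ⟨0, le_rfl, fun ι S χ l i₀ hi hS => ?_⟩
    rw [Finset.card_eq_zero] at hS
    simp [hS] at hi
  | succ s ih =>
    -- A single factor is treated apart, since mixing only speaks of at least two factors.
    rcases Nat.eq_zero_or_pos s with rfl | hs
    · refine ⟨0, le_rfl, fun ι S χ l i₀ hi hS _ h1 => ⟨S, subset_rfl, hi, h1, fun i hiS => ?_⟩⟩
      rw [Finset.card_le_one.mp (by omega) i hiS i₀ hi, sub_self, norm_zero]
    obtain ⟨M₁, hM₁⟩ := hT.exists_uniform (r := s + 1) (by omega) F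
    have hfin : (Metric.ball (0 : Fin d → ℤ) M₁).Finite :=
      (isCompact_closedBall (0 : Fin d → ℤ) M₁).finite_of_discrete.subset Metric.ball_subset_closedBall
    -- If two points are closer than `M₁`, their factors are merged into one placed at the first
    -- point. The merged elements range over a finite set, so induction on the number of factors
    -- applies to `F'`.
    set F' : Finset Γ := F ∪ ((F ×ˢ F) ×ˢ hfin.toFinset).image
      (fun p => p.1.1 * T p.2 p.1.2) with hF'
    obtain ⟨M₂, hM₂0, hM₂⟩ := ih F'
    refine ⟨M₂ + max M₁ 0, by positivity, fun ι S χ l i₀ hi₀ hS hF h1 => ?_⟩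
    by_cases hχ : χ i₀ = 1
    · exact ⟨{i₀}, by simpa using hi₀, by simp, by simp [hχ], fun i hi => by
        rw [Finset.mem_singleton.mp hi, sub_self, norm_zero]; positivity⟩
    by_cases hsep : ∀ i ∈ S, ∀ j ∈ S, i ≠ j → M₁ ≤ ‖l i - l j‖
    · exfalso
      let e := (Finset.equivFinOfCardEq hS).symm
      refine hM₁ (fun k => χ (e k)) (fun k => hF _ (e k).2) ⟨e.symm ⟨i₀, hi₀⟩, by simpa using hχ⟩
        (fun k => l (e k)) (fun a b hab => hsep _ (e a).2 _ (e b).2 fun h =>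
          hab (e.injective (Subtype.ext h))) ?_
      rw [← h1, ← Finset.prod_coe_sort S]
      exact Fintype.prod_equiv e _ _ fun _ => rfl
    push Not at hsep
    -- The index `j` is the one absorbed by the merging, so it is chosen different from `i₀`.
    obtain ⟨i, j, hi, hj, hij, hji, hlt⟩ : ∃ i j, i ∈ S ∧ j ∈ S ∧ i ≠ j ∧ j ≠ i₀ ∧
        ‖l j - l i‖ < M₁ := by
      obtain ⟨i, hi, j, hj, hij, hlt⟩ := hsep
      by_cases hj0 : j = i₀
      · exact ⟨j, i, hj, hi, hij.symm, fun h => hij (h.trans hj0.symm), hlt⟩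
      · exact ⟨i, j, hi, hj, hij, hj0, by rwa [norm_sub_rev]⟩
    have hM₁0 : 0 ≤ M₁ := (norm_nonneg _).trans hlt.le
    set χ' : ι → Γ := Function.update χ i (χ i * T (l j - l i) (χ j)) with hχ'
    have hsplit : T (l i) (χ' i) = T (l i) (χ i) * T (l j) (χ j) := by
      rw [hχ', Function.update_self, map_mul, ← T.map_add, add_sub_cancel]
    have hother : ∀ k, k ≠ i → χ' k = χ k := fun k hk => Function.update_of_ne hk _ _
    have hprod : ∀ B : Finset ι, i ∈ B → j ∉ B →
        ∏ k ∈ B, T (l k) (χ' k) = ∏ k ∈ insert j B, T (l k) (χ k) := by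
      intro B hiB hjB
      rw [Finset.prod_insert hjB, ← Finset.mul_prod_erase B _ hiB, hsplit,
        ← Finset.mul_prod_erase B (fun k => T (l k) (χ k)) hiB,
        Finset.prod_congr rfl fun k hk => by rw [hother k (Finset.ne_of_mem_erase hk)]]
      rw [mul_comm (T (l i) (χ i)), mul_assoc]
    obtain ⟨B, hBS, hiB, hB1, hBM⟩ := hM₂ ι (S.erase j) χ' l i₀
      (Finset.mem_erase.mpr ⟨hji.symm, hi₀⟩) (by rw [Finset.card_erase_of_mem hj]; omega)
      (by
        intro k hk
        by_cases hki : k = i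
        · subst hki
          rw [hF', Finset.mem_union]
          right
          rw [Finset.mem_image]
          exact ⟨((χ k, χ j), l j - l k), by simp [hF k hi, hF j hj, hlt], by
            rw [hχ', Function.update_self]⟩
        · rw [hother k hki]
          exact Finset.mem_union_left _ (hF k (Finset.mem_of_mem_erase hk)))
      (by
        rw [hprod _ (Finset.mem_erase.mpr ⟨hij, hi⟩) (Finset.notMem_erase _ _),
          Finset.insert_erase hj, h1])
    have hjB : j ∉ B := fun h => Finset.notMem_erase j S (hBS h)
    have hBS' : B ⊆ S := hBS.trans (Finset.erase_subset _ _)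
    -- Undoing the merging: `j` joins the block exactly when `i` belongs to it.
    by_cases hiB' : i ∈ B
    · refine ⟨insert j B, Finset.insert_subset hj hBS', Finset.mem_insert_of_mem hiB,
        by rw [← hprod B hiB' hjB, hB1], fun k hk => ?_⟩
      rcases Finset.mem_insert.mp hk with rfl | hk
      · calc ‖l k - l i₀‖ = ‖(l i - l i₀) + (l k - l i)‖ := by congr 1; abel
          _ ≤ ‖l i - l i₀‖ + ‖l k - l i‖ := norm_add_le _ _
          _ ≤ M₂ + max M₁ 0 := add_le_add (hBM i hiB') (hlt.le.trans (le_max_left _ _))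
      · exact (hBM k hk).trans (by simp)
    · refine ⟨B, hBS', hiB, ?_, fun k hk => (hBM k hk).trans (by simp)⟩
      rw [← hB1]
      exact Finset.prod_congr rfl fun k hk => by rw [hother k fun h => hiB' (h ▸ hk)]

end EndAction

/-! ### Local times and counting of close visits -/

section LocalTime

variable {d : ℕ} (z : ℕ → Fin d → ℤ) (n : ℕ)

theorem localTime_le_maxLocalTime (l : Fin d → ℤ) : localTime z n l ≤ maxLocalTime z n := by
  refine le_ciSup (f := localTime z n) ⟨n, ?_⟩ l
  rintro _ ⟨l, rfl⟩
  exact (Finset.card_filter_le _ _).trans (by simp)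

theorem sum_range_comp {M : Type*} [AddCommMonoid M] (g : (Fin d → ℤ) → M) :
    ∑ k ∈ Finset.range n, g (z k) =
      ∑ l ∈ (Finset.range n).image z, localTime z n l • g l := by
  rw [Finset.sum_comp]
  rfl

theorem localTime_eq_zero {l : Fin d → ℤ} (hl : l ∉ (Finset.range n).image z) :
    localTime z n l = 0 := by
  rw [localTime, Finset.card_eq_zero, Finset.filter_eq_empty_iff]
  exact fun k hk h => hl (Finset.mem_image.mpr ⟨k, hk, h⟩)

/-- The number of pairs `k, k' < n` with `z_{k'} = z_k + m`. -/
def differenceCount (m : Fin d → ℤ) : ℕ :=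
  ((Finset.range n ×ˢ Finset.range n).filter fun p => z p.2 = z p.1 + m).card

theorem differenceCount_eq (m : Fin d → ℤ) :
    differenceCount z n m = ∑ k ∈ Finset.range n, localTime z n (z k + m) := by
  simp only [differenceCount, localTime, Finset.card_filter, Finset.sum_product]

theorem selfIntersections_eq_sum : selfIntersections z n =
    ∑ k ∈ Finset.range n, localTime z n (z k) := by
  simp only [selfIntersections, localTime, Finset.card_filter, Finset.sum_product]
  exact Finset.sum_congr rfl fun _ _ => Finset.sum_congr rfl fun _ _ => by simp only [eq_comm]

theorem selfIntersections_eq_sum_sq : selfIntersections z n =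
    ∑ l ∈ (Finset.range n).image z, localTime z n l ^ 2 := by
  rw [selfIntersections_eq_sum, sum_range_comp z n (fun l => localTime z n l)]
  simp only [smul_eq_mul, sq]

theorem sum_sq_localTime_le (S : Finset (Fin d → ℤ)) :
    ∑ l ∈ S, localTime z n l ^ 2 ≤ selfIntersections z n := by
  rw [selfIntersections_eq_sum_sq]
  calc ∑ l ∈ S, localTime z n l ^ 2
      ≤ ∑ l ∈ S ∪ (Finset.range n).image z, localTime z n l ^ 2 :=
        Finset.sum_le_sum_of_subset Finset.subset_union_left
    _ = ∑ l ∈ (Finset.range n).image z, localTime z n l ^ 2 := by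
        refine (Finset.sum_subset Finset.subset_union_right fun l _ hl => ?_).symm
        rw [localTime_eq_zero z n hl, zero_pow two_ne_zero]

/-- The count is `∑ R(l) R(l + m)`, and `2 R(l) R(l + m) ≤ R(l)² + R(l + m)²`. -/
theorem differenceCount_le (m : Fin d → ℤ) : differenceCount z n m ≤ selfIntersections z n := by
  rw [differenceCount_eq, sum_range_comp z n (fun l => localTime z n (l + m))]
  have h1 := sum_sq_localTime_le z n ((Finset.range n).image z)
  have h2 := sum_sq_localTime_le z n (((Finset.range n).image z).map (addRightEmbedding m))
  rw [Finset.sum_map] at h2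
  have h3 : 2 * ∑ l ∈ (Finset.range n).image z, localTime z n l • localTime z n (l + m) ≤
      ∑ l ∈ (Finset.range n).image z, localTime z n l ^ 2 +
      ∑ l ∈ (Finset.range n).image z, localTime z n (l + m) ^ 2 := by
    rw [Finset.mul_sum, ← Finset.sum_add_distrib]
    refine Finset.sum_le_sum fun l _ => ?_
    rw [smul_eq_mul, ← mul_assoc]
    exact two_mul_le_add_sq _ _
  simp only [addRightEmbedding_apply] at h2
  omega

/-- The times at which `z` is at distance at most `M` from `z k`. -/
def nearTimes (M : ℝ) (k : ℕ) : Finset ℕ :=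
  (Finset.range n).filter fun k' => ‖z k' - z k‖ ≤ M

/-- The integer points of the ball of radius `M`. -/
def latticeBall (d : ℕ) (M : ℝ) : Finset (Fin d → ℤ) :=
  (isCompact_closedBall (0 : Fin d → ℤ) M).finite_of_discrete.toFinset

theorem mem_latticeBall {M : ℝ} {m : Fin d → ℤ} : m ∈ latticeBall d M ↔ ‖m‖ ≤ M := by
  simp [latticeBall]

theorem card_nearTimes (M : ℝ) (k : ℕ) :
    (nearTimes z n M k).card = ∑ m ∈ latticeBall d M, localTime z n (z k + m) := by
  rw [Finset.card_eq_sum_card_fiberwise (f := fun k' => z k' - z k) (t := latticeBall d M)]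
  · refine Finset.sum_congr rfl fun m hm => ?_
    rw [mem_latticeBall] at hm
    rw [localTime, nearTimes, Finset.filter_filter]
    congr 1
    ext k'
    simp only [Finset.mem_filter]
    constructor
    · rintro ⟨h1, -, h2⟩
      exact ⟨h1, by rw [← h2]; abel⟩
    · rintro ⟨h1, h2⟩
      have : z k' - z k = m := by rw [h2]; abel
      exact ⟨h1, by rwa [this], this⟩
  · intro k' hk'
    exact mem_latticeBall.mpr (Finset.mem_filter.mp hk').2

theorem card_nearTimes_le (M : ℝ) (k : ℕ) :
    (nearTimes z n M k).card ≤ (latticeBall d M).card * maxLocalTime z n := by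
  rw [card_nearTimes, ← smul_eq_mul]
  exact Finset.sum_le_card_nsmul _ _ _ fun m _ => localTime_le_maxLocalTime z n _

theorem sum_card_nearTimes_le (M : ℝ) :
    ∑ k ∈ Finset.range n, (nearTimes z n M k).card ≤
      (latticeBall d M).card * selfIntersections z n := by
  simp only [card_nearTimes]
  rw [Finset.sum_comm, ← smul_eq_mul]
  refine Finset.sum_le_card_nsmul _ _ _ fun m _ => ?_
  rw [← differenceCount_eq]
  exact differenceCount_le z n m

/-- The growth condition on the local times. -/
def HasSmallLocalTimes : Prop :=
  ∀ r : ℕ, 3 ≤ r →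
      (fun n : ℕ => (n : ℝ) * (maxLocalTime z n : ℝ) ^ (r - 1)) =o[atTop]
        (fun n : ℕ => (selfIntersections z n : ℝ) ^ ((r : ℝ) / 2))

variable {z}

/-- Each of the `n` summands is at most a constant times `(sup R_n)^(b-1)`. The growth hypothesis
enters the argument here. -/
theorem HasSmallLocalTimes.isLittleO (hz : HasSmallLocalTimes z) (M : ℝ) {b : ℕ} (hb : 3 ≤ b) :
    (fun n : ℕ => ((∑ k ∈ Finset.range n, (nearTimes z n M k).card ^ (b - 1) : ℕ) : ℝ)) =o[atTop]
      (fun n : ℕ => (selfIntersections z n : ℝ) ^ ((b : ℝ) / 2)) := by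
  refine IsBigO.trans_isLittleO ?_ (hz b hb)
  refine IsBigO.of_bound (((latticeBall d M).card : ℝ) ^ (b - 1)) (Eventually.of_forall fun n => ?_)
  rw [Real.norm_of_nonneg (by positivity), Real.norm_of_nonneg (by positivity)]
  have : ∑ k ∈ Finset.range n, (nearTimes z n M k).card ^ (b - 1) ≤
      n * ((latticeBall d M).card * maxLocalTime z n) ^ (b - 1) := by
    calc _ ≤ (Finset.range n).card • ((latticeBall d M).card * maxLocalTime z n) ^ (b - 1) :=
          Finset.sum_le_card_nsmul _ _ _ fun k _ =>
            Nat.pow_le_pow_left (card_nearTimes_le z n M k) _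
      _ = _ := by rw [Finset.card_range, smul_eq_mul]
  calc ((∑ k ∈ Finset.range n, (nearTimes z n M k).card ^ (b - 1) : ℕ) : ℝ)
      ≤ ((n * ((latticeBall d M).card * maxLocalTime z n) ^ (b - 1) : ℕ) : ℝ) := by
        exact_mod_cast this
    _ = _ := by push_cast; ring

/-- For `b = 2` the growth hypothesis is not involved: close pairs of times are split by their
difference, and each difference occurs at most `v_n` times. -/
theorem HasSmallLocalTimes.isBigO (hz : HasSmallLocalTimes z) (M : ℝ) {b : ℕ} (hb : 2 ≤ b) :
    (fun n : ℕ => ((∑ k ∈ Finset.range n, (nearTimes z n M k).card ^ (b - 1) : ℕ) : ℝ)) =O[atTop]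
      (fun n : ℕ => (selfIntersections z n : ℝ) ^ ((b : ℝ) / 2)) := by
  rcases hb.eq_or_lt with rfl | hb
  · refine IsBigO.of_bound ((latticeBall d M).card : ℝ) (Eventually.of_forall fun n => ?_)
    rw [Real.norm_of_nonneg (by positivity), Real.norm_of_nonneg (by positivity)]
    simp only [Nat.add_one_sub_one, pow_one, Nat.cast_ofNat, div_self (two_ne_zero (α := ℝ)),
      Real.rpow_one]
    exact_mod_cast sum_card_nearTimes_le z n M
  · exact (hz.isLittleO M hb).isBigO

end LocalTime

/-! ### Counting tuples of translates with trivial product -/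

section TrivialProducts

variable {d : ℕ} {Γ : Type*} [CommGroup Γ] (T : EndAction d Γ) (z : ℕ → Fin d → ℤ)
  {κ : Type*} [Fintype κ] (ch : κ → Γ)

/-- The translate attached to a time and to one of finitely many elements. -/
def translate {n : ℕ} (p : Fin n × κ) : Γ := T (z p.1) (ch p.2)

open Classical in
/-- The tuples with trivial product. -/
def trivialTuples (n : ℕ) (ι : Type) [Fintype ι] : Finset (ι → Fin n × κ) :=
  Finset.univ.filter fun p => ∏ i, translate T z ch (p i) = 1

open Classical in
/-- The tuples which are localized on `B` and have trivial product off `B`. -/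
def nearTuples (n : ℕ) {ι : Type} [Fintype ι] (M : ℝ) (B : Finset ι) (i₀ : ι) :
    Finset (ι → Fin n × κ) :=
  Finset.univ.filter fun p => (∀ i ∈ B, ‖z (p i).1 - z (p i₀).1‖ ≤ M) ∧
    ∏ i : {i // i ∉ B}, translate T z ch (p i) = 1

theorem mem_trivialTuples {n : ℕ} {ι : Type} [Fintype ι] {p : ι → Fin n × κ} :
    p ∈ trivialTuples T z ch n ι ↔ ∏ i, translate T z ch (p i) = 1 := by
  simp [trivialTuples]

open Classical in
theorem mem_nearTuples {n : ℕ} {ι : Type} [Fintype ι] {M : ℝ} {B : Finset ι} {i₀ : ι}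
    {p : ι → Fin n × κ} : p ∈ nearTuples T z ch n M B i₀ ↔
      (∀ i ∈ B, ‖z (p i).1 - z (p i₀).1‖ ≤ M) ∧
        ∏ i : {i // i ∉ B}, translate T z ch (p i) = 1 := by
  simp [nearTuples]

-- A tuple is determined by its entry at `i₀`, its other entries on `B`, which are confined to times
-- near that of `i₀`, and its restriction off `B`, which again has trivial product.
open Classical in
theorem card_nearTuples_le (n : ℕ) {ι : Type} [Fintype ι] (M : ℝ) (B : Finset ι) (i₀ : ι)
    (hi₀ : i₀ ∈ B) :
    (nearTuples T z ch n M B i₀).card ≤ (Fintype.card κ ^ B.card *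
      ∑ k ∈ Finset.range n, (nearTimes z n M k).card ^ (B.card - 1)) *
      (trivialTuples T z ch n {i // i ∉ B}).card := by
  let near : Fin n × κ → Finset (Fin n × κ) := fun q =>
    Finset.univ.filter fun p => ‖z p.1 - z q.1‖ ≤ M
  have hnear : ∀ q, (near q).card = (nearTimes z n M q.1).card * Fintype.card κ := by
    intro q
    have : near q = (Finset.univ.filter fun k : Fin n => ‖z k - z q.1‖ ≤ M) ×ˢ Finset.univ := by
      ext p; simp [near]
    rw [this, Finset.card_product, Finset.card_univ, nearTimes, Finset.card_filter,
      Finset.card_filter, ← Fin.sum_univ_eq_sum_range (fun k => if ‖z k - z q.1‖ ≤ M then 1 else 0)]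
  let b₀ : {i // i ∈ B} := ⟨i₀, hi₀⟩
  let loc : Fin n × κ → Finset ({i // i ∈ B} → Fin n × κ) := fun q =>
    Fintype.piFinset fun i => if i = b₀ then {q} else near q
  have hloc : ∀ q, (loc q).card =
      ((nearTimes z n M q.1).card * Fintype.card κ) ^ (B.card - 1) := by
    intro q
    rw [Fintype.card_piFinset, ← Finset.mul_prod_erase _ _ (Finset.mem_univ b₀), if_pos rfl,
      Finset.card_singleton, one_mul, Finset.prod_congr rfl fun i hi => by
        rw [if_neg (Finset.ne_of_mem_erase hi), hnear], Finset.prod_const,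
      Finset.card_erase_of_mem (Finset.mem_univ _), Finset.card_univ, Fintype.card_coe]
  have hB : B.card = B.card - 1 + 1 := by
    have := Finset.card_pos.mpr ⟨i₀, hi₀⟩
    omega
  have hsum : ∑ q, (loc q).card = Fintype.card κ ^ B.card *
      ∑ k ∈ Finset.range n, (nearTimes z n M k).card ^ (B.card - 1) := by
    simp only [hloc]
    rw [Fintype.sum_prod_type, ← Fin.sum_univ_eq_sum_range
      (fun k => (nearTimes z n M k).card ^ (B.card - 1)), Finset.mul_sum]
    refine Finset.sum_congr rfl fun k _ => ?_
    simp only []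
    rw [Finset.sum_const, Finset.card_univ, smul_eq_mul, mul_pow]
    conv_rhs => rw [hB, pow_succ, ← hB]
    ring
  rw [← hsum]
  refine le_trans (Finset.card_le_card_of_injOn
    (t := (Finset.univ.biUnion loc) ×ˢ trivialTuples T z ch n {i // i ∉ B})
    (Equiv.piEquivPiSubtypeProd (fun i => i ∈ B) fun _ => Fin n × κ) ?_
    (Equiv.injective _).injOn) ?_
  · intro p hp
    obtain ⟨hp1, hp2⟩ := (Finset.mem_filter.mp hp).2
    refine Finset.mem_product.mpr ⟨Finset.mem_biUnion.mpr ⟨p i₀, Finset.mem_univ _,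
      Fintype.mem_piFinset.mpr fun i => ?_⟩, (mem_trivialTuples T z ch).mpr hp2⟩
    split_ifs with hi
    · rw [hi]; exact Finset.mem_singleton_self _
    · exact Finset.mem_filter.mpr ⟨Finset.mem_univ _, hp1 i i.2⟩
  · rw [Finset.card_product]
    exact Nat.mul_le_mul_right _ Finset.card_biUnion_le

variable {T z ch}

theorem selfIntersections_rpow_mul {s : ℕ} {b : ℕ} (hb : b ≤ s) (n : ℕ) :
    (selfIntersections z n : ℝ) ^ ((b : ℝ) / 2) *
      (selfIntersections z n : ℝ) ^ (((s - b : ℕ) : ℝ) / 2) =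
      (selfIntersections z n : ℝ) ^ ((s : ℝ) / 2) := by
  rw [← Real.rpow_add_of_nonneg (by positivity) (by positivity) (by positivity), Nat.cast_sub hb]
  congr 1
  ring

open Classical in
theorem isBigO_card_nearTuples {ι : Type} [Fintype ι] (M : ℝ) (B : Finset ι) (i₀ : ι)
    (hi₀ : i₀ ∈ B) :
    (fun n => ((nearTuples T z ch n M B i₀).card : ℝ)) =O[atTop] fun n =>
      ((∑ k ∈ Finset.range n, (nearTimes z n M k).card ^ (B.card - 1) : ℕ) : ℝ) *
        ((trivialTuples T z ch n {i // i ∉ B}).card : ℝ) := by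
  refine IsBigO.of_bound ((Fintype.card κ : ℝ) ^ B.card) (Eventually.of_forall fun n => ?_)
  rw [Real.norm_of_nonneg (by positivity), Real.norm_of_nonneg (by positivity), ← mul_assoc]
  exact_mod_cast card_nearTuples_le T z ch n M B i₀ hi₀

theorem card_subtype_notMem {ι : Type} [Fintype ι] (B : Finset ι) [Fintype {i // i ∉ B}] :
    Fintype.card {i // i ∉ B} = Fintype.card ι - B.card := by
  classical
  rw [Fintype.card_of_subtype Bᶜ (by simp), Finset.card_compl]

/-- A tuple with trivial product is localized on a set containing any given index. -/
theorem exists_mem_nearTuples (hT : T.IsMixing) (s : ℕ) (ch : κ → Γ) : ∃ M : ℝ, 0 ≤ M ∧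
    ∀ (ι : Type) (S : Finset ι) (i₀ : ι) (n : ℕ) (p : ι → Fin n × κ), i₀ ∈ S → S.card ≤ s →
      ∏ i ∈ S, translate T z ch (p i) = 1 → ∃ B ⊆ S, i₀ ∈ B ∧
        ∏ i ∈ B, translate T z ch (p i) = 1 ∧ ∀ i ∈ B, ‖z (p i).1 - z (p i₀).1‖ ≤ M := by
  classical
  choose M hM0 hM using fun t => hT.exists_near_subproduct t (Finset.univ.image ch)
  -- The sum dominates the radii for all sizes up to `s` at once.
  refine ⟨∑ t ∈ Finset.range (s + 1), M t, Finset.sum_nonneg fun t _ => hM0 t, ?_⟩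
  intro ι S i₀ n p hi₀ hS h1
  obtain ⟨B, hBS, hB, hB1, hBM⟩ := hM S.card ι S (fun i => ch (p i).2) (fun i => z (p i).1) i₀ hi₀
    rfl (fun i _ => Finset.mem_image_of_mem _ (Finset.mem_univ _)) h1
  exact ⟨B, hBS, hB, hB1, fun i hi => (hBM i hi).trans
    (Finset.single_le_sum (f := M) (fun t _ => hM0 t) (Finset.mem_range.mpr (by omega)))⟩

theorem prod_subtype_notMem_eq_one {ι : Type} [Fintype ι] {B : Finset ι} [Fintype {i // i ∉ B}]
    {y : ι → Γ} (h : ∏ i, y i = 1) (hB : ∏ i ∈ B, y i = 1) : ∏ i : {i // i ∉ B}, y i = 1 := by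
  classical
  rw [← Finset.prod_mul_prod_compl B, hB, one_mul] at h
  rw [← h]
  exact (Finset.prod_subtype _ (by simp) y).symm

omit [Fintype κ] in
theorem translate_ne_one (hch : ∀ a, ch a ≠ 1) {n : ℕ} (q : Fin n × κ) :
    translate T z ch q ≠ 1 := fun h => hch q.2 ((EndAction.apply_eq_one_iff _ _).mp h)

theorem two_le_card_of_prod_eq_one {ι : Type} {B : Finset ι} {i₀ : ι} (hi₀ : i₀ ∈ B) {y : ι → Γ}
    (hy : y i₀ ≠ 1) (h : ∏ i ∈ B, y i = 1) : 2 ≤ B.card := by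
  by_contra hlt
  have : B = {i₀} := Finset.eq_singleton_iff_unique_mem.mpr
    ⟨hi₀, fun i hi => Finset.card_le_one.mp (by omega) i hi i₀ hi₀⟩
  rw [this, Finset.prod_singleton] at h
  exact hy h

/-- Strong induction on the length: a localized block around a fixed index has `b ≥ 2` elements,
since no factor is trivial. It contributes `O(v_n^(b/2))`, and the rest is a trivial tuple of length
`s - b`. -/
theorem HasSmallLocalTimes.isBigO_trivialTuples (hz : HasSmallLocalTimes z) (hT : T.IsMixing)
    (hch : ∀ a, ch a ≠ 1) (s : ℕ) : ∀ (ι : Type) [Fintype ι], Fintype.card ι = s →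
      (fun n => ((trivialTuples T z ch n ι).card : ℝ)) =O[atTop]
        fun n => (selfIntersections z n : ℝ) ^ ((s : ℝ) / 2) := by
  classical
  induction s using Nat.strong_induction_on with
  | _ s ih =>
    intro ι _ hι
    rcases isEmpty_or_nonempty ι with hE | ⟨⟨i₀⟩⟩
    · rw [Fintype.card_eq_zero] at hι
      subst hι
      refine IsBigO.of_bound 1 (Eventually.of_forall fun n => ?_)
      simp only [CharP.cast_eq_zero, zero_div, Real.rpow_zero, norm_one, mul_one, Real.norm_natCast]
      exact_mod_cast (Finset.card_le_univ _).trans (by simp)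
    obtain ⟨M, hM0, hM⟩ := exists_mem_nearTuples (z := z) hT s ch
    have hsub : ∀ n, trivialTuples T z ch n ι ⊆
        ((Finset.univ : Finset (Finset ι)).filter fun B => i₀ ∈ B ∧ 2 ≤ B.card).biUnion
          fun B => nearTuples T z ch n M B i₀ := by
      intro n p hp
      rw [mem_trivialTuples] at hp
      obtain ⟨B, -, hB, hB1, hBM⟩ := hM ι Finset.univ i₀ n p (Finset.mem_univ _) hι.le hp
      exact Finset.mem_biUnion.mpr ⟨B, Finset.mem_filter.mpr ⟨Finset.mem_univ _, hB,
        two_le_card_of_prod_eq_one hB (translate_ne_one hch _) hB1⟩,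
        (mem_nearTuples T z ch).mpr ⟨hBM, prod_subtype_notMem_eq_one hp hB1⟩⟩
    have hle : (fun n => ((trivialTuples T z ch n ι).card : ℝ)) =O[atTop] fun n =>
        ∑ B ∈ (Finset.univ : Finset (Finset ι)).filter (fun B => i₀ ∈ B ∧ 2 ≤ B.card),
          ((nearTuples T z ch n M B i₀).card : ℝ) := by
      refine IsBigO.of_bound 1 (Eventually.of_forall fun n => ?_)
      rw [one_mul, Real.norm_of_nonneg (by positivity), Real.norm_of_nonneg (by positivity)]
      exact_mod_cast (Finset.card_le_card (hsub n)).trans Finset.card_biUnion_le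
    refine hle.trans (IsBigO.fun_sum fun B hB => ?_)
    obtain ⟨hB0, hB2⟩ := (Finset.mem_filter.mp hB).2
    have hBs : B.card ≤ s := hι ▸ Finset.card_le_univ B
    refine (isBigO_card_nearTuples M B i₀ hB0).trans ?_
    refine ((hz.isBigO M hB2).mul (ih (s - B.card) (by omega) {i // i ∉ B}
      (by rw [card_subtype_notMem, hι]))).congr_right fun n => ?_
    exact selfIntersections_rpow_mul hBs n

theorem HasSmallLocalTimes.isLittleO_nearTuples (hz : HasSmallLocalTimes z) (hT : T.IsMixing)
    (hch : ∀ a, ch a ≠ 1) {ι : Type} [Fintype ι] (M : ℝ) {B : Finset ι} {i₀ : ι}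
    (hB0 : i₀ ∈ B) (hB3 : 3 ≤ B.card) :
    (fun n => ((nearTuples T z ch n M B i₀).card : ℝ)) =o[atTop]
      fun n => (selfIntersections z n : ℝ) ^ ((Fintype.card ι : ℝ) / 2) := by
  classical
  refine (isBigO_card_nearTuples M B i₀ hB0).trans_isLittleO ?_
  refine ((hz.isLittleO M hB3).mul_isBigO (hz.isBigO_trivialTuples hT hch _ {i // i ∉ B}
      (card_subtype_notMem B))).congr_right fun n => ?_
  exact selfIntersections_rpow_mul (Finset.card_le_univ B) n

open Classical in
/-- The tuples with trivial product in which the first factor is not inverse to exactly one other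
factor. -/
def irregularTuples (T : EndAction d Γ) (z : ℕ → Fin d → ℤ) (ch : κ → Γ) (n r : ℕ) :
    Finset (Fin (r + 1) → Fin n × κ) :=
  (trivialTuples T z ch n (Fin (r + 1))).filter fun p =>
    (Finset.univ.filter fun j : Fin r =>
      translate T z ch (p 0) * translate T z ch (p j.succ) = 1).card ≠ 1

/-- Every irregular tuple has a localized trivial block of size at least three containing index `0`,
and such blocks gain the little-o. -/
theorem HasSmallLocalTimes.isLittleO_irregularTuples (hz : HasSmallLocalTimes z)
    (hT : T.IsMixing) (hch : ∀ a, ch a ≠ 1) (r : ℕ) :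
    (fun n => ((irregularTuples T z ch n r).card : ℝ)) =o[atTop]
      fun n => (selfIntersections z n : ℝ) ^ (((r + 1 : ℕ) : ℝ) / 2) := by
  classical
  -- The size bound `r + 2` covers both pairs and the full set of `r + 1` indices, also when `r =
  -- 0`.
  obtain ⟨M, hM0, hM⟩ := exists_mem_nearTuples (z := z) hT (r + 2) ch
  have hsub : ∀ n, irregularTuples T z ch n r ⊆
      ((Finset.univ : Finset (Finset (Fin (r + 1)))).filter fun B => 0 ∈ B ∧ 3 ≤ B.card).biUnion
          fun B => nearTuples T z ch n (M + M) B 0 := by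
    intro n p hp
    obtain ⟨hp1, hp2⟩ := Finset.mem_filter.mp hp
    rw [mem_trivialTuples] at hp1
    set y : Fin (r + 1) → Γ := fun i => translate T z ch (p i) with hy
    have hy1 : ∀ i, y i ≠ 1 := fun i => translate_ne_one hch _
    suffices h : ∃ B : Finset (Fin (r + 1)), 0 ∈ B ∧ 3 ≤ B.card ∧ ∏ i ∈ B, y i = 1 ∧
        ∀ i ∈ B, ‖z (p i).1 - z (p 0).1‖ ≤ M + M by
      obtain ⟨B, h0, h3, h1, hBM⟩ := h
      refine Finset.mem_biUnion.mpr ⟨B, Finset.mem_filter.mpr ⟨Finset.mem_univ _, h0, h3⟩,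
        (mem_nearTuples T z ch).mpr ⟨hBM, ?_⟩⟩
      convert! prod_subtype_notMem_eq_one hp1 h1
    -- With two partners `j` and `k` of index `0`, the pair `{0, j}` is joined to a block of its
    -- complement around `k`. Since `k` is itself close to `0`, the union is localized with radius
    -- `M + M`.
    rcases Nat.lt_or_ge 1 (Finset.univ.filter fun j : Fin r => y 0 * y j.succ = 1).card with h | h
    · obtain ⟨j, hj, k, hk, hjk⟩ := Finset.one_lt_card.mp h
      have hj := (Finset.mem_filter.mp hj).2
      have hk := (Finset.mem_filter.mp hk).2
      have hnear : ∀ i : Fin r, y 0 * y i.succ = 1 → ‖z (p i.succ).1 - z (p 0).1‖ ≤ M := by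
        intro i hi
        obtain ⟨B, hBS, hB0, hB1, hBM⟩ := hM (Fin (r + 1)) {0, i.succ} 0 n p (by simp)
          (Finset.card_le_two.trans (by omega))
          (by rwa [Finset.prod_pair (Fin.succ_ne_zero i).symm])
        refine hBM _ ?_
        -- The block inside the pair has at least two elements, hence is the whole pair.
        have h2 := two_le_card_of_prod_eq_one hB0 (hy1 0) hB1
        rw [Finset.eq_of_subset_of_card_le hBS (Finset.card_le_two.trans h2)]
        simp
      have hpair : ∏ i ∈ ({0, j.succ} : Finset (Fin (r + 1))), y i = 1 := by
        rwa [Finset.prod_pair (Fin.succ_ne_zero j).symm]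
      have hrest : ∏ i ∈ ({0, j.succ} : Finset (Fin (r + 1)))ᶜ, y i = 1 := by
        rw [← hp1, ← Finset.prod_mul_prod_compl {0, j.succ} y, hpair, one_mul]
      obtain ⟨B, hBS, hBk, hB1, hBM⟩ := hM (Fin (r + 1)) {0, j.succ}ᶜ k.succ n p
        (by simp [hjk.symm])
        ((Finset.card_le_univ _).trans (by simp)) hrest
      have hdis : Disjoint ({0, j.succ} : Finset (Fin (r + 1))) B :=
        Finset.disjoint_left.mpr fun i hi hiB => Finset.mem_compl.mp (hBS hiB) hi
      refine ⟨{0, j.succ} ∪ B, by simp, ?_, ?_, ?_⟩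
      · rw [Finset.card_union_of_disjoint hdis, Finset.card_pair (Fin.succ_ne_zero j).symm]
        have := Finset.card_pos.mpr ⟨_, hBk⟩
        omega
      · rw [Finset.prod_union hdis, hpair, hB1, one_mul]
      · intro i hi
        rcases Finset.mem_union.mp hi with hi | hi
        · rcases Finset.mem_insert.mp hi with rfl | hi
          · rw [sub_self, norm_zero]; positivity
          · rw [Finset.mem_singleton.mp hi]
            exact (hnear j hj).trans (by linarith)
        · calc ‖z (p i).1 - z (p 0).1‖
              = ‖(z (p i).1 - z (p k.succ).1) + (z (p k.succ).1 - z (p 0).1)‖ := by congr 1; abel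
            _ ≤ _ := norm_add_le _ _
            _ ≤ M + M := add_le_add (hBM i hi) (hnear k hk)
    · have h0 : (Finset.univ.filter fun j : Fin r => y 0 * y j.succ = 1) = ∅ :=
        Finset.card_eq_zero.mp (Nat.lt_one_iff.mp (lt_of_le_of_ne h (by convert! hp2)))
      obtain ⟨B, -, hB0, hB1, hBM⟩ := hM (Fin (r + 1)) Finset.univ 0 n p (Finset.mem_univ _)
        (by simp) hp1
      have h2 := two_le_card_of_prod_eq_one hB0 (hy1 0) hB1
      refine ⟨B, hB0, ?_, hB1, fun i hi => (hBM i hi).trans (by linarith)⟩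
      -- Without a partner of index `0`, a block around `0` cannot have size two: its other element
      -- would be a partner.
      by_contra hlt
      obtain ⟨i, hi⟩ : ∃ i, B.erase 0 = {i} := by
        rw [← Finset.card_eq_one, Finset.card_erase_of_mem hB0]
        omega
      have hi0 : i ≠ 0 := Finset.ne_of_mem_erase (hi ▸ Finset.mem_singleton_self i)
      obtain ⟨j, rfl⟩ := Fin.exists_succ_eq.mpr hi0
      rw [← Finset.mul_prod_erase B _ hB0, hi, Finset.prod_singleton] at hB1
      exact Finset.notMem_empty j (h0 ▸ Finset.mem_filter.mpr ⟨Finset.mem_univ _, hB1⟩)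
  have hle : (fun n => ((irregularTuples T z ch n r).card : ℝ)) =O[atTop] fun n =>
      ∑ B ∈ (Finset.univ : Finset (Finset (Fin (r + 1)))).filter
        (fun B => 0 ∈ B ∧ 3 ≤ B.card), ((nearTuples T z ch n (M + M) B 0).card : ℝ) := by
    refine IsBigO.of_bound 1 (Eventually.of_forall fun n => ?_)
    rw [one_mul, Real.norm_of_nonneg (by positivity), Real.norm_of_nonneg (by positivity)]
    exact_mod_cast (Finset.card_le_card (hsub n)).trans Finset.card_biUnion_le
  refine hle.trans_isLittleO (IsLittleO.fun_sum fun B hB => ?_)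
  obtain ⟨hB0, hB3⟩ := (Finset.mem_filter.mp hB).2
  simpa using hz.isLittleO_nearTuples hT hch (M + M) hB0 hB3

end TrivialProducts

/-! ### The Gaussian recursion for the weighted counts -/

section Moments

variable {d : ℕ} {Γ : Type*} [CommGroup Γ] (T : EndAction d Γ) (z : ℕ → Fin d → ℤ)
  {κ : Type*} [Fintype κ] (ch : κ → Γ) (w : κ → ℂ)

open Classical in
/-- The weighted number of tuples with trivial product. -/
def momentSum (n r : ℕ) : ℂ :=
  ∑ p : Fin r → Fin n × κ, if ∏ i, translate T z ch (p i) = 1 then ∏ i, w (p i).2 else 0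

theorem momentSum_zero (n : ℕ) : momentSum T z ch w n 0 = 1 := by
  simp [momentSum]

theorem momentSum_one (hch : ∀ a, ch a ≠ 1) (n : ℕ) : momentSum T z ch w n 1 = 0 := by
  rw [momentSum]
  refine Finset.sum_eq_zero fun p _ => if_neg ?_
  rw [Fin.prod_univ_one]
  exact translate_ne_one hch _

open Classical in
theorem momentSum_two (n : ℕ) : momentSum T z ch w n 2 = ∑ q : Fin n × κ, ∑ q' : Fin n × κ,
    if translate T z ch q * translate T z ch q' = 1 then w q.2 * w q'.2 else 0 := by
  rw [momentSum, ← (finTwoArrowEquiv (Fin n × κ)).symm.sum_comp, Fintype.sum_prod_type]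
  simp [Fin.prod_univ_two]

theorem prod_insertNth_insertNth {M P : Type*} [CommMonoid M] (g : P → M) {r : ℕ}
    (j : Fin (r + 1)) (q q' : P) (p : Fin r → P) :
    ∏ i, g (Fin.insertNthEquiv (fun _ => P) 0 (q, Fin.insertNthEquiv (fun _ => P) j (q', p)) i) =
      g q * g q' * ∏ i, g (p i) := by
  rw [Fin.prod_univ_succAbove _ 0, Fin.prod_univ_succAbove _ j]
  simp [mul_assoc]

-- Once the pair has product `1`, the total product is `1` exactly when the remaining product is.
-- Hence the sum factors after removing the entries `0` and `j.succ`.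
open Classical in
theorem sum_paired_tuples (n r : ℕ) (j : Fin (r + 1)) :
    ∑ p : Fin (r + 2) → Fin n × κ, (if ∏ i, translate T z ch (p i) = 1 ∧
      translate T z ch (p 0) * translate T z ch (p j.succ) = 1 then ∏ i, w (p i).2 else 0) =
      momentSum T z ch w n 2 * momentSum T z ch w n r := by
  rw [momentSum_two, momentSum, ← (Fin.insertNthEquiv (fun _ => Fin n × κ) 0).sum_comp,
    Fintype.sum_prod_type, Finset.sum_mul]
  refine Finset.sum_congr rfl fun q _ => ?_
  rw [← (Fin.insertNthEquiv (fun _ => Fin n × κ) j).sum_comp, Fintype.sum_prod_type,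
    Finset.sum_mul]
  refine Finset.sum_congr rfl fun q' _ => ?_
  rw [Finset.mul_sum]
  refine Finset.sum_congr rfl fun p _ => ?_
  have hw : ∏ i, w (Fin.insertNthEquiv (fun _ => Fin n × κ) 0
      (q, Fin.insertNthEquiv (fun _ => Fin n × κ) j (q', p)) i).2 =
      w q.2 * w q'.2 * ∏ i, w (p i).2 := prod_insertNth_insertNth (fun q => w q.2) j q q' p
  rw [prod_insertNth_insertNth, hw]
  have h0 : Fin.insertNthEquiv (fun _ => Fin n × κ) 0
      (q, Fin.insertNthEquiv (fun _ => Fin n × κ) j (q', p)) 0 = q := by simp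
  have hj : Fin.insertNthEquiv (fun _ => Fin n × κ) 0
      (q, Fin.insertNthEquiv (fun _ => Fin n × κ) j (q', p)) j.succ = q' := by simp
  rw [h0, hj]
  by_cases h1 : translate T z ch q * translate T z ch q' = 1
  · simp only [h1, one_mul, and_true, if_true, mul_ite, mul_zero]
  · simp only [h1, and_false, if_false, zero_mul]

/-- The subtracted term sums over all possible partners `j` of index `0`. A regular tuple is counted
there exactly once and cancels; an irregular one leaves at most `1 + (r + 1)` terms bounded by `C ^
(r + 2)`. -/
theorem norm_momentSum_sub_le {C : ℝ} (hw : ∀ a, ‖w a‖ ≤ C) (n r : ℕ) :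
    ‖momentSum T z ch w n (r + 2) - (r + 1) * (momentSum T z ch w n 2 * momentSum T z ch w n r)‖ ≤
      C ^ (r + 2) * (r + 2) * (irregularTuples T z ch n (r + 1)).card := by
  classical
  have h1 : ((r : ℂ) + 1) * (momentSum T z ch w n 2 * momentSum T z ch w n r) =
      ∑ p : Fin (r + 2) → Fin n × κ, ∑ j : Fin (r + 1), (if ∏ i, translate T z ch (p i) = 1 ∧
      translate T z ch (p 0) * translate T z ch (p j.succ) = 1 then ∏ i, w (p i).2 else 0) := by
    rw [Finset.sum_comm, Finset.sum_congr rfl fun j _ => sum_paired_tuples T z ch w n r j]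
    simp
  rw [h1, momentSum, ← Finset.sum_sub_distrib,
    ← Finset.sum_subset (Finset.subset_univ (irregularTuples T z ch n (r + 1)))]
  · refine (norm_sum_le_of_le _ (f := fun p : Fin (r + 2) → Fin n × κ => _)
      (n := fun _ => C ^ (r + 2) * (r + 2)) fun p hp => ?_).trans ?_
    · have hW : ‖∏ i, w (p i).2‖ ≤ C ^ (r + 2) := by
        rw [norm_prod]
        exact (Finset.prod_le_prod (fun _ _ => norm_nonneg _) fun i _ => hw _).trans (by simp)
      have hite : ∀ (P : Prop) [Decidable P], ‖if P then ∏ i, w (p i).2 else 0‖ ≤ C ^ (r + 2) := by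
        intro P _
        split_ifs
        · exact hW
        · rw [norm_zero]; exact (norm_nonneg _).trans hW
      refine (norm_sub_le _ _).trans ?_
      refine (add_le_add (hite _) (norm_sum_le_of_le _ fun j _ => hite _)).trans ?_
      simp only [Finset.sum_const, Finset.card_univ, Fintype.card_fin, nsmul_eq_mul]
      push_cast
      linarith
    · rw [Finset.sum_const, nsmul_eq_mul, mul_comm]
  · intro p _ hp
    by_cases h : ∏ i, translate T z ch (p i) = 1
    · have hJ : (Finset.univ.filter fun j : Fin (r + 1) =>
          translate T z ch (p 0) * translate T z ch (p j.succ) = 1).card = 1 := by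
        by_contra hne
        exact hp (Finset.mem_filter.mpr ⟨(mem_trivialTuples T z ch).mpr h, hne⟩)
      simp only [h, true_and, if_true]
      rw [← Finset.sum_filter, Finset.sum_const, hJ, one_smul, sub_self]
    · simp [h]

variable {T z ch}

/-- The moments of a centered Gaussian variable of variance `v`. -/
def gaussianMoment (v : ℝ) : ℕ → ℝ
  | 0 => 1
  | 1 => 0
  | (r + 2) => (r + 1) * v * gaussianMoment v r

theorem HasSmallLocalTimes.tendsto_momentSum (hz : HasSmallLocalTimes z) (hT : T.IsMixing)
    (hch : ∀ a, ch a ≠ 1) {v : ℝ}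
    (h2 : Tendsto (fun n => momentSum T z ch w n 2 / (selfIntersections z n : ℝ)) atTop (𝓝 (v : ℂ)))
    (r : ℕ) : Tendsto (fun n => momentSum T z ch w n r /
      ((selfIntersections z n : ℝ) ^ ((r : ℝ) / 2) : ℝ)) atTop (𝓝 (gaussianMoment v r : ℂ)) := by
  induction r using Nat.twoStepInduction with
  | zero => simp [momentSum_zero, gaussianMoment]
  | one => simp [momentSum_one T z ch w hch, gaussianMoment]
  | more r ih _ =>
    obtain ⟨C, hC⟩ : ∃ C, ∀ a, ‖w a‖ ≤ C :=
      ⟨∑ a, ‖w a‖, fun a => Finset.single_le_sum (f := fun a => ‖w a‖) (fun _ _ => norm_nonneg _)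
        (Finset.mem_univ a)⟩
    have hlo : (fun n => momentSum T z ch w n (r + 2) -
        (r + 1) * (momentSum T z ch w n 2 * momentSum T z ch w n r)) =o[atTop]
        fun n => (selfIntersections z n : ℝ) ^ (((r + 2 : ℕ) : ℝ) / 2) := by
      refine IsBigO.trans_isLittleO ?_ (hz.isLittleO_irregularTuples hT hch (r + 1))
      refine IsBigO.of_bound (C ^ (r + 2) * (r + 2)) (Eventually.of_forall fun n => ?_)
      rw [Real.norm_natCast]
      exact norm_momentSum_sub_le T z ch w hC n r
    have h3 : Tendsto (fun n => (momentSum T z ch w n (r + 2) -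
        (r + 1) * (momentSum T z ch w n 2 * momentSum T z ch w n r)) /
        (((selfIntersections z n : ℝ) ^ (((r + 2 : ℕ) : ℝ) / 2) : ℝ) : ℂ)) atTop (𝓝 0) := by
      refine IsLittleO.tendsto_div_nhds_zero (IsLittleO.of_norm_right ?_)
      simpa using hlo.norm_right
    have h4 := h3.add (((h2.mul ih).const_mul ((r : ℂ) + 1)))
    rw [zero_add] at h4
    convert! h4 using 2 with n
    · have : ((selfIntersections z n : ℝ) ^ (((r + 2 : ℕ) : ℝ) / 2)) =
          (selfIntersections z n : ℝ) * (selfIntersections z n : ℝ) ^ ((r : ℝ) / 2) := by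
        rw [← selfIntersections_rpow_mul (b := 2) (s := r + 2) (by omega)]
        simp
      rw [this]
      push_cast
      rw [sub_div, div_mul_div_comm, mul_div_assoc]
      ring
    · rw [gaussianMoment]; push_cast; ring

end Moments

/-! ### Characters of the compact group and the dual action -/

section Characters

variable {d : ℕ} {G : Type*} [CommGroup G] [TopologicalSpace G]
  [IsTopologicalGroup G] [CompactSpace G] [T2Space G] [MeasurableSpace G] [BorelSpace G]

/-- The dual action on characters. -/
def AutAction.dual (A : AutAction d G) : EndAction d (PontryaginDual G) where
  toFun l := (PontryaginDual.map (A l : G →ₜ* G)).toMonoidHom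
  map_zero χ := by
    ext x
    exact congrArg (fun y => ((χ y : Circle) : ℂ)) (A.map_zero x)
  map_add l m χ := by
    ext x
    -- Dualizing reverses composition, which is harmless because `ℤ^d` is commutative.
    exact congrArg (fun y => ((χ y : Circle) : ℂ)) (by rw [add_comm]; exact A.map_add m l x)

theorem prod_dual_apply {ι : Type*} (S : Finset ι) (χ : ι → PontryaginDual G) (x : G) :
    (∏ i ∈ S, χ i) x = ∏ i ∈ S, χ i x := by
  classical
  induction S using Finset.induction_on with
  | empty => simp
  | insert i S hi ih => rw [Finset.prod_insert hi, Finset.prod_insert hi, ← ih]; rfl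

variable (μ : Measure G) [μ.IsHaarMeasure] [IsProbabilityMeasure μ]

theorem AutAction.measurePreserving (A : AutAction d G) (l : Fin d → ℤ) :
    MeasurePreserving (A l) μ μ := by
  refine ⟨(A l).continuous.measurable, ?_⟩
  have h1 : (μ.map (A l)).IsHaarMeasure :=
    (A l).toMulEquiv.isHaarMeasure_map μ (A l).continuous (A l).symm.continuous
  have h2 : IsProbabilityMeasure (μ.map (A l)) :=
    Measure.isProbabilityMeasure_map (A l).continuous.measurable.aemeasurable
  exact Measure.isHaarMeasure_eq_of_isProbabilityMeasure _ _

theorem AutAction.measurableEmbedding (A : AutAction d G) (l : Fin d → ℤ) :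
    MeasurableEmbedding (A l) := (A l).toHomeomorph.measurableEmbedding

omit [IsTopologicalGroup G] [CompactSpace G] [T2Space G] [MeasurableSpace G] [BorelSpace G] in
theorem continuous_character (χ : PontryaginDual G) : Continuous fun x => (χ x : ℂ) :=
  continuous_induced_dom.comp (map_continuous χ)

-- If `χ a ≠ 1`, translation by `a` multiplies the integral by `χ a`, so it vanishes.
open Classical in
theorem integral_character (χ : PontryaginDual G) :
    ∫ x, (χ x : ℂ) ∂μ = if χ = 1 then 1 else 0 := by
  split_ifs with h
  · simp [h]
  · obtain ⟨a, ha⟩ : ∃ a, χ a ≠ 1 := by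
      by_contra! hall
      exact h (PontryaginDual.ext hall)
    have h1 := integral_mul_left_eq_self (μ := μ) (fun x => (χ x : ℂ)) a
    simp only [map_mul, Circle.coe_mul] at h1
    rw [integral_const_mul] at h1
    have h2 : ((χ a : ℂ) - 1) * ∫ x, (χ x : ℂ) ∂μ = 0 := by rw [sub_mul, h1, one_mul, sub_self]
    refine (mul_eq_zero.mp h2).resolve_left fun h3 => ha ?_
    exact Circle.coe_injective (by simpa [sub_eq_zero] using h3)

/-- Choose nonempty open sets `B i` such that `∏ χ i (b i) ≠ 1` whenever all `b i ∈ B i`. If the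
product of translated characters is `1`, the sets `A (n i) ⁻¹' B i` have empty intersection, while
mixing brings its measure within `∏ μ (B i) > 0` of that product. -/
theorem IsMixingOfAllOrders.isMixing_dual {A : AutAction d G} (hA : IsMixingOfAllOrders A μ) :
    A.dual.IsMixing := by
  classical
  intro r hr χ ⟨i₀, hi₀⟩
  obtain ⟨g, hg⟩ : ∃ g, χ i₀ g ≠ 1 := by
    by_contra! hall
    exact hi₀ (PontryaginDual.ext hall)
  let a : Fin r → G := fun i => if i = i₀ then g else 1
  have ha : ∏ i, χ i (a i) ≠ 1 := by
    rw [Finset.prod_eq_single i₀ (fun i _ hi => by simp [a, hi]) (by simp)]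
    simpa [a] using hg
  obtain ⟨U, hU, hUsub⟩ := isOpen_pi_iff'.mp
    (isOpen_compl_singleton.preimage (continuous_finsetProd (M := Circle) Finset.univ
      fun i _ => continuous_apply i) : IsOpen {u : Fin r → Circle | ∏ i, u i ≠ 1}) _ ha
  let B : Fin r → Set G := fun i => χ i ⁻¹' U i
  have hBo : ∀ i, IsOpen (B i) := fun i => (hU i).1.preimage (map_continuous (χ i))
  have hpos : 0 < ∏ i, μ.real (B i) := Finset.prod_pos fun i _ =>
    ENNReal.toReal_pos ((hBo i).measure_pos μ ⟨a i, (hU i).2⟩).ne' (measure_ne_top _ _)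
  obtain ⟨M, hM⟩ := hA r hr B (fun i => (hBo i).measurableSet) _ hpos
  refine ⟨M, fun n hn h1 => ?_⟩
  have hempty : ⋂ i, A (n i) ⁻¹' B i = ∅ := by
    rw [Set.eq_empty_iff_forall_notMem]
    intro x hx
    have hx' : (fun i => χ i (A (n i) x)) ∈ {u : Fin r → Circle | ∏ i, u i ≠ 1} :=
      hUsub fun i _ => Set.mem_iInter.mp hx i
    refine hx' ?_
    have := DFunLike.congr_fun h1 x
    rwa [prod_dual_apply] at this
  have := hM n hn
  rw [hempty, measureReal_empty, zero_sub, abs_neg, abs_of_pos hpos] at this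
  exact lt_irrefl _ this

end Characters

/-! ### Correlations of absolutely convergent character series -/

section CharSeries

variable {d : ℕ} {G : Type*} [CommGroup G] [TopologicalSpace G]
  [IsTopologicalGroup G] [CompactSpace G] [T2Space G] [MeasurableSpace G] [BorelSpace G]

/-- `f` is the sum of an absolutely convergent series of nontrivial characters. -/
structure IsCharSeries (μ : Measure G) (f : G → ℝ) {κ : Type*} (ch : κ → PontryaginDual G)
    (w : κ → ℂ) : Prop where
  nontrivial : ∀ a, ch a ≠ 1
  summable : Summable fun a => ‖w a‖
  aestronglyMeasurable : AEStronglyMeasurable f μ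
  hasSum : ∀ᵐ x ∂μ, HasSum (fun a => w a * (ch a x : ℂ)) (f x : ℂ)

/-- The correlation `⟨A^l f, f⟩`. -/
def correlation (A : AutAction d G) (μ : Measure G) (f : G → ℝ) (l : Fin d → ℤ) : ℝ :=
  ∫ x, f (A l x) * f x ∂μ

variable {μ : Measure G} [μ.IsHaarMeasure] [IsProbabilityMeasure μ] {A : AutAction d G} {f : G → ℝ}

theorem integral_mul_eq_correlation (l m : Fin d → ℤ) :
    ∫ x, f (A l x) * f (A m x) ∂μ = correlation A μ f (l - m) := by
  rw [correlation, ← (A.measurePreserving μ m).integral_comp (A.measurableEmbedding m)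
    fun x => f (A (l - m) x) * f x]
  simp only [← A.map_add, sub_add_cancel]

theorem correlation_neg (l : Fin d → ℤ) :
    correlation A μ f (-l) = correlation A μ f l := by
  rw [← zero_sub, ← integral_mul_eq_correlation, correlation]
  simp only [A.map_zero, mul_comm]

theorem memLp_comp {p : ENNReal} (hf : MemLp f p μ) (l : Fin d → ℤ) :
    MemLp (fun x => f (A l x)) p μ :=
  hf.comp_measurePreserving (A.measurePreserving μ l)

namespace IsCharSeries

variable {κ : Type*} {ch : κ → PontryaginDual G} {w : κ → ℂ}

theorem abs_le (hf : IsCharSeries μ f ch w) : ∀ᵐ x ∂μ, ‖f x‖ ≤ ∑' a, ‖w a‖ := by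
  filter_upwards [hf.hasSum] with x hx
  rw [← Complex.norm_real, ← hx.tsum_eq]
  have : ∀ a, ‖w a * (ch a x : ℂ)‖ = ‖w a‖ := fun a => by rw [norm_mul, Circle.norm_coe, mul_one]
  refine (norm_tsum_le_tsum_norm (by simpa only [this] using hf.summable)).trans ?_
  simp only [this, le_refl]

theorem memLp (hf : IsCharSeries μ f ch w) (p : ENNReal) : MemLp f p μ :=
  MemLp.of_bound hf.aestronglyMeasurable _ hf.abs_le

open Classical in
theorem hasSum_correlation [Countable κ] (hf : IsCharSeries μ f ch w) (A : AutAction d G)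
    (l : Fin d → ℤ) : HasSum (fun a : κ × κ => w a.1 * w a.2 *
      if A.dual l (ch a.1) * ch a.2 = 1 then 1 else 0) (correlation A μ f l : ℂ) := by
  let F : κ × κ → G → ℂ := fun a x => w a.1 * w a.2 * ((A.dual l (ch a.1) * ch a.2) x : ℂ)
  have hnorm : ∀ a x, ‖F a x‖ = ‖w a.1‖ * ‖w a.2‖ := fun a x => by
    simp only [F, norm_mul, Circle.norm_coe, mul_one]
  have hFi : ∀ a, Integrable (F a) μ := fun a =>
    Integrable.of_bound ((continuous_character _).const_mul _).aestronglyMeasurable _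
      (Eventually.of_forall fun x => (hnorm a x).le)
  have hs : Summable fun a : κ × κ => ‖w a.1‖ * ‖w a.2‖ :=
    hf.summable.mul_of_nonneg hf.summable (fun _ => norm_nonneg _) fun _ => norm_nonneg _
  have h := hasSum_integral_of_summable_integral_norm hFi (by simpa [hnorm] using hs)
  convert! h using 1
  · ext a
    rw [integral_const_mul, integral_character]
  · rw [correlation, ← integral_complex_ofReal]
    refine integral_congr_ae ?_
    filter_upwards [hf.hasSum, (A.measurePreserving μ l).quasiMeasurePreserving.ae hf.hasSum]
      with x hx hx'
    have hprod := hx'.mul hx (by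
      refine Summable.of_norm ?_
      simpa only [norm_mul, Circle.norm_coe, mul_one] using hs)
    rw [Complex.ofReal_mul, ← hprod.tsum_eq]
    refine tsum_congr fun a => ?_
    change _ = w a.1 * w a.2 * ((ch a.1 (A l x) * ch a.2 x : Circle) : ℂ)
    rw [Circle.coe_mul]
    ring

/-- After expanding into pairs of characters and exchanging the sums, each pair contributes for at
most one `l`, because a nontrivial character has trivial stabilizer. -/
theorem sum_norm_correlation_le [Countable κ] (hA : A.dual.IsMixing) (hf : IsCharSeries μ f ch w)
    (L : Finset (Fin d → ℤ)) : ∑ l ∈ L, ‖correlation A μ f l‖ ≤ (∑' a, ‖w a‖) ^ 2 := by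
  classical
  have hs : Summable fun a : κ × κ => ‖w a.1‖ * ‖w a.2‖ :=
    hf.summable.mul_of_nonneg hf.summable (fun _ => norm_nonneg _) fun _ => norm_nonneg _
  have hl : ∀ l, Summable fun a : κ × κ => ‖w a.1‖ * ‖w a.2‖ *
      if A.dual l (ch a.1) * ch a.2 = 1 then (1 : ℝ) else 0 := fun l =>
    Summable.of_nonneg_of_le (fun a => by positivity)
      (fun a => by
        refine mul_le_of_le_one_right (by positivity) ?_
        split_ifs <;> norm_num) hs
  calc ∑ l ∈ L, ‖correlation A μ f l‖
      ≤ ∑ l ∈ L, ∑' a : κ × κ, ‖w a.1‖ * ‖w a.2‖ *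
          if A.dual l (ch a.1) * ch a.2 = 1 then (1 : ℝ) else 0 := by
        refine Finset.sum_le_sum fun l _ => ?_
        rw [← Complex.norm_real, ← (hf.hasSum_correlation A l).tsum_eq]
        have hn : ∀ a : κ × κ, ‖w a.1 * w a.2 *
            (if A.dual l (ch a.1) * ch a.2 = 1 then (1 : ℂ) else 0)‖ = ‖w a.1‖ * ‖w a.2‖ *
            if A.dual l (ch a.1) * ch a.2 = 1 then (1 : ℝ) else 0 := fun a => by
          split_ifs <;> simp
        refine (norm_tsum_le_tsum_norm (by simpa only [hn] using hl l)).trans ?_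
        simp only [hn, le_refl]
    _ = ∑' a : κ × κ, ∑ l ∈ L, ‖w a.1‖ * ‖w a.2‖ *
          (if A.dual l (ch a.1) * ch a.2 = 1 then (1 : ℝ) else 0) :=
        (Summable.tsum_finsetSum fun l _ => hl l).symm
    _ ≤ ∑' a : κ × κ, ‖w a.1‖ * ‖w a.2‖ := by
        refine Summable.tsum_le_tsum (fun a => ?_) (summable_sum fun l _ => hl l) hs
        rw [← Finset.mul_sum]
        refine mul_le_of_le_one_right (by positivity) ?_
        rw [Finset.sum_boole]
        rw [Nat.cast_le_one, Finset.card_le_one]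
        intro l hl m hm
        exact hA.eq_of_apply_eq (hf.nontrivial a.1) (mul_right_cancel
          ((Finset.mem_filter.mp hl).2.trans (Finset.mem_filter.mp hm).2.symm))
    _ = (∑' a, ‖w a‖) ^ 2 := by
        rw [sq, hf.summable.tsum_mul_tsum hf.summable hs]

theorem summable_correlation [Countable κ] (hA : A.dual.IsMixing) (hf : IsCharSeries μ f ch w) :
    Summable fun l => ‖correlation A μ f l‖ :=
  summable_of_sum_le (fun _ => norm_nonneg _) (hf.sum_norm_correlation_le hA)

end IsCharSeries

/-- The sum of `f` along the first `n` points of `z`. -/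
def birkhoff (A : AutAction d G) (z : ℕ → Fin d → ℤ) (f : G → ℝ) (n : ℕ) (x : G) : ℝ :=
  ∑ k ∈ Finset.range n, f (A (z k) x)

theorem memLp_birkhoff {p : ENNReal} (hf : MemLp f p μ) (z : ℕ → Fin d → ℤ) (n : ℕ) :
    MemLp (birkhoff A z f n) p μ :=
  memLp_finsetSum _ fun k _ => memLp_comp hf (z k)

theorem integral_birkhoff_sq (hf : MemLp f 2 μ) (z : ℕ → Fin d → ℤ) (n : ℕ) :
    ∫ x, birkhoff A z f n x ^ 2 ∂μ = ∑ k ∈ Finset.range n, ∑ k' ∈ Finset.range n,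
      correlation A μ f (z k - z k') := by
  simp only [birkhoff, sq, Finset.sum_mul_sum]
  have hint : ∀ k k', Integrable (fun x => f (A (z k) x) * f (A (z k') x)) μ := fun k k' =>
    (memLp_comp hf (z k)).integrable_mul (memLp_comp hf (z k'))
  rw [integral_finsetSum _ fun k _ => integrable_finsetSum _ fun k' _ => hint k k']
  refine Finset.sum_congr rfl fun k _ => ?_
  rw [integral_finsetSum _ fun k' _ => hint k k']
  exact Finset.sum_congr rfl fun k' _ => integral_mul_eq_correlation _ _

/-- Pairs of times are grouped by their difference; each difference occurs at most `v_n` times, and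
the correlations are absolutely summable. Uniformity in `n` is what makes truncation possible. -/
theorem integral_birkhoff_sq_le {κ : Type*} [Countable κ] {ch : κ → PontryaginDual G} {w : κ → ℂ}
    (hA : A.dual.IsMixing) (hf : IsCharSeries μ f ch w) (z : ℕ → Fin d → ℤ) (n : ℕ) :
    ∫ x, birkhoff A z f n x ^ 2 ∂μ ≤ selfIntersections z n * (∑' a, ‖w a‖) ^ 2 := by
  classical
  rw [integral_birkhoff_sq (hf.memLp 2), ← Finset.sum_product']
  have h1 : ∑ p ∈ Finset.range n ×ˢ Finset.range n, correlation A μ f (z p.1 - z p.2) =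
      ∑ m ∈ (Finset.range n ×ˢ Finset.range n).image (fun p => z p.1 - z p.2),
        (differenceCount z n (-m) : ℝ) * correlation A μ f m := by
    rw [Finset.sum_comp (fun m => correlation A μ f m) (fun p : ℕ × ℕ => z p.1 - z p.2)]
    refine Finset.sum_congr rfl fun m _ => ?_
    rw [nsmul_eq_mul, differenceCount]
    congr 3
    ext p
    simp only [Finset.mem_filter, and_congr_right_iff]
    intro _
    constructor <;> intro h
    · rw [← h]; abel
    · rw [h]; abel
  rw [h1]
  calc _ ≤ ∑ m ∈ (Finset.range n ×ˢ Finset.range n).image (fun p => z p.1 - z p.2),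
        (selfIntersections z n : ℝ) * ‖correlation A μ f m‖ := by
        refine Finset.sum_le_sum fun m _ => ?_
        refine (mul_le_mul_of_nonneg_left (le_abs_self _) (by positivity)).trans
          (mul_le_mul_of_nonneg_right ?_ (abs_nonneg _))
        exact_mod_cast differenceCount_le z n (-m)
    _ ≤ _ := by
        rw [← Finset.mul_sum]
        exact mul_le_mul_of_nonneg_left (hf.sum_norm_correlation_le hA _) (by positivity)

end CharSeries

/-! ### The continuous spectral density -/

section SpectralDensity

open UnitAddTorus

section Torus

variable {d : ℕ}

instance : IsProbabilityMeasure (torusHaar d) := by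
  unfold torusHaar; infer_instance

instance : (torusHaar d).IsOpenPosMeasure := by
  unfold torusHaar; infer_instance

theorem integral_fourier (n : ℤ) :
    ∫ t : UnitAddCircle, (fourier n t : ℂ) ∂AddCircle.haarAddCircle = if n = 0 then 1 else 0 := by
  split_ifs with h
  · simp [h]
  · exact integral_eq_zero_of_add_right_eq_neg (fourier_add_half_inv_index h one_pos)

theorem integral_mFourier (l : Fin d → ℤ) :
    ∫ t, mFourier l t ∂torusHaar d = if l = 0 then 1 else 0 := by
  have h := integral_fintype_prod_eq_prod (μ := fun _ : Fin d => AddCircle.haarAddCircle (T := 1))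
    (fun (i : Fin d) (t : UnitAddCircle) => (fourier (l i) t : ℂ))
  refine h.trans ?_
  simp only [integral_fourier]
  split_ifs with hl
  · simp [hl]
  · obtain ⟨i, hi⟩ := Function.ne_iff.mp hl
    exact Finset.prod_eq_zero (Finset.mem_univ i) (if_neg hi)

theorem norm_mFourier_apply (l : Fin d → ℤ) (t : UnitAddTorus (Fin d)) : ‖mFourier l t‖ = 1 := by
  rw [mFourier, ContinuousMap.coe_mk, norm_prod]
  exact Finset.prod_eq_one fun i _ => Circle.norm_coe _

theorem mFourier_mul_conj (l m : Fin d → ℤ) (t : UnitAddTorus (Fin d)) :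
    mFourier l t * (starRingEnd ℂ) (mFourier m t) = mFourier (l - m) t := by
  rw [← mFourier_neg, ← mFourier_add, sub_eq_add_neg]

theorem integrable_continuousMap {E : Type*} [NormedAddCommGroup E] [SecondCountableTopology E]
    (g : C(UnitAddTorus (Fin d), E)) : Integrable g (torusHaar d) :=
  g.continuous.integrable_of_hasCompactSupport (HasCompactSupport.of_compactSpace _)

end Torus

variable {d : ℕ} {G : Type*} [CommGroup G] [TopologicalSpace G]
  [IsTopologicalGroup G] [CompactSpace G] [T2Space G] [MeasurableSpace G] [BorelSpace G]
  {μ : Measure G} [μ.IsHaarMeasure] [IsProbabilityMeasure μ] {A : AutAction d G} {f : G → ℝ}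

theorem isSpectralDensity_iff {φ : C(UnitAddTorus (Fin d), ℝ)} :
    IsSpectralDensity A μ f φ ↔ (∀ t, 0 ≤ φ t) ∧ ∀ l : Fin d → ℤ,
      ∫ t, mFourier (-l) t * (φ t : ℂ) ∂torusHaar d = correlation A μ f l := by
  refine and_congr_right fun h0 => ?_
  have hmeas : Measurable fun t => ENNReal.ofReal (φ t) := φ.continuous.measurable.ennreal_ofReal
  have hint : ∀ l : Fin d → ℤ, ∫ t, mFourier (-l) t ∂((torusHaar d).withDensity
      fun t => ENNReal.ofReal (φ t)) = ∫ t, mFourier (-l) t * (φ t : ℂ) ∂torusHaar d := by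
    intro l
    rw [integral_withDensity_eq_integral_toReal_smul hmeas (by simp)]
    refine integral_congr_ae (Eventually.of_forall fun t => ?_)
    simp only [ENNReal.toReal_ofReal (h0 t), Complex.real_smul, mul_comm]
  constructor
  · intro h l
    rw [← hint, h.coeff]
    rfl
  · intro h
    refine ⟨isFiniteMeasure_withDensity_ofReal (integrable_continuousMap φ).2, fun l => ?_⟩
    rw [hint, h]
    rfl

/-- The isometry between trigonometric polynomials and combinations of translates of `f`. -/
theorem integral_norm_sq_mul_eq {φ : UnitAddTorus (Fin d) → ℝ} (hf : MemLp f 2 μ)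
    (hφi : Integrable φ (torusHaar d))
    (hφ : ∀ l : Fin d → ℤ, ∫ t, mFourier (-l) t * (φ t : ℂ) ∂torusHaar d = correlation A μ f l)
    {ι : Type*} (S : Finset ι) (c : ι → ℂ) (l : ι → Fin d → ℤ) :
    ∫ t, ‖∑ i ∈ S, c i * mFourier (l i) t‖ ^ 2 * φ t ∂torusHaar d =
      ∫ x, ‖∑ i ∈ S, c i * (f (A (l i) x) : ℂ)‖ ^ 2 ∂μ := by
  have hsq : ∀ u : ι → ℂ, ((‖∑ i ∈ S, c i * u i‖ ^ 2 : ℝ) : ℂ) = ∑ i ∈ S, ∑ j ∈ S,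
      c i * (starRingEnd ℂ) (c j) * (u i * (starRingEnd ℂ) (u j)) := by
    intro u
    rw [Complex.ofReal_pow, ← Complex.mul_conj', map_sum, Finset.sum_mul_sum]
    refine Finset.sum_congr rfl fun i _ => Finset.sum_congr rfl fun j _ => ?_
    rw [map_mul]
    ring
  apply Complex.ofReal_injective
  rw [← integral_complex_ofReal, ← integral_complex_ofReal]
  simp only [Complex.ofReal_mul, hsq, Complex.conj_ofReal, mFourier_mul_conj, Finset.sum_mul]
  have h1 : ∀ i j, Integrable (fun t => c i * (starRingEnd ℂ) (c j) * mFourier (l i - l j) t *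
      (φ t : ℂ)) (torusHaar d) := fun i j => by
    refine hφi.ofReal.bdd_mul (c := ‖c i * (starRingEnd ℂ) (c j)‖) ?_ ?_
    · exact ((mFourier _).continuous.const_mul _).aestronglyMeasurable
    · exact Eventually.of_forall fun t => by rw [norm_mul _ (mFourier _ t), norm_mFourier_apply, mul_one]
  have h2 : ∀ i j, Integrable (fun x => c i * (starRingEnd ℂ) (c j) *
      ((f (A (l i) x) : ℂ) * (f (A (l j) x) : ℂ))) μ := fun i j => by
    refine Integrable.const_mul ?_ _
    have := ((memLp_comp (A := A) hf (l i)).integrable_mul (memLp_comp (A := A) hf (l j))).ofReal (𝕜 := ℂ)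
    simpa using this
  rw [integral_finsetSum _ fun i _ => integrable_finsetSum _ fun j _ => h1 i j,
    integral_finsetSum _ fun i _ => integrable_finsetSum _ fun j _ => h2 i j]
  refine Finset.sum_congr rfl fun i _ => ?_
  rw [integral_finsetSum _ fun j _ => h1 i j, integral_finsetSum _ fun j _ => h2 i j]
  refine Finset.sum_congr rfl fun j _ => ?_
  simp only [mul_assoc]
  rw [integral_const_mul, integral_const_mul, integral_const_mul, integral_const_mul]
  congr 2
  have h3 := hφ (l j - l i)
  rw [neg_sub] at h3
  rw [h3, ← integral_mul_eq_correlation, ← integral_complex_ofReal]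
  simp only [Complex.ofReal_mul, mul_comm]

theorem sum_sequentialSummation (z : ℕ → Fin d → ℤ) (n : ℕ) (t : UnitAddTorus (Fin d)) :
    ∑' l, (sequentialSummation z n l : ℂ) * mFourier l t =
      ∑ k ∈ Finset.range n, mFourier (z k) t := by
  classical
  rw [sum_range_comp z n (fun l => mFourier l t), tsum_eq_sum (s := (Finset.range n).image z)]
  · refine Finset.sum_congr rfl fun l _ => ?_
    rw [nsmul_eq_mul]
    simp [sequentialSummation]
  · intro l hl
    simp [sequentialSummation, localTime_eq_zero z n hl]

theorem sum_sq_sequentialSummation (z : ℕ → Fin d → ℤ) (n : ℕ) :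
    ∑' l, sequentialSummation z n l ^ 2 = selfIntersections z n := by
  classical
  rw [tsum_eq_sum (s := (Finset.range n).image z), selfIntersections_eq_sum_sq]
  · push_cast
    rfl
  · intro l hl
    simp [sequentialSummation, localTime_eq_zero z n hl]

theorem integral_birkhoff_sq_eq {φ : C(UnitAddTorus (Fin d), ℝ)} (hf : MemLp f 2 μ)
    (hφ : ∀ l : Fin d → ℤ, ∫ t, mFourier (-l) t * (φ t : ℂ) ∂torusHaar d = correlation A μ f l)
    (z : ℕ → Fin d → ℤ) (n : ℕ) :
    (∫ x, birkhoff A z f n x ^ 2 ∂μ) / selfIntersections z n =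
      ∫ t, normalizedKernel (sequentialSummation z n) t * φ t ∂torusHaar d := by
  have h := integral_norm_sq_mul_eq (A := A) hf (integrable_continuousMap φ) hφ (Finset.range n)
    (fun _ => 1) z
  simp only [one_mul] at h
  have hb : ∀ x, birkhoff A z f n x ^ 2 = ‖∑ k ∈ Finset.range n, (f (A (z k) x) : ℂ)‖ ^ 2 := by
    intro x
    rw [← Complex.ofReal_sum, Complex.norm_real, Real.norm_eq_abs, sq_abs]
    rfl
  simp only [hb, ← h, normalizedKernel, sum_sequentialSummation, sum_sq_sequentialSummation,
    div_mul_eq_mul_div]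
  rw [integral_div]

/-- By the isometry, `∫ |g|² φ ≥ 0` for trigonometric polynomials `g`, hence for all continuous `g`
by density. -/
theorem nonneg_of_correlation {φ : C(UnitAddTorus (Fin d), ℝ)} (hf : MemLp f 2 μ)
    (hφ : ∀ l : Fin d → ℤ, ∫ t, mFourier (-l) t * (φ t : ℂ) ∂torusHaar d = correlation A μ f l)
    (t : UnitAddTorus (Fin d)) : 0 ≤ φ t := by
  let Q : C(UnitAddTorus (Fin d), ℂ) → ℝ := fun g => ∫ t, ‖g t‖ ^ 2 * φ t ∂torusHaar d
  have hQc : Continuous Q := by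
    refine continuous_iff_continuousAt.mpr fun g₀ => ?_
    refine continuousAt_of_dominated (bound := fun _ => (‖g₀‖ + 1) ^ 2 * ‖φ‖)
      (Eventually.of_forall fun g => Continuous.aestronglyMeasurable (by fun_prop)) ?_
      (integrable_const _) (Eventually.of_forall fun t =>
        ((((continuous_eval_const t).norm).pow 2).mul continuous_const).continuousAt)
    filter_upwards [Metric.ball_mem_nhds g₀ one_pos] with g hg
    refine Eventually.of_forall fun t => ?_
    rw [norm_mul, norm_pow, norm_norm]
    have h1 : ‖g t‖ ≤ ‖g₀‖ + 1 := by
      have h2 : ‖g - g₀‖ < 1 := by rwa [← dist_eq_norm]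
      linarith [g.norm_coe_le_norm t, norm_le_norm_add_norm_sub' g g₀]
    exact mul_le_mul (pow_le_pow_left₀ (norm_nonneg _) h1 2) (φ.norm_coe_le_norm t)
      (norm_nonneg _) (by positivity)
  have hQ : ∀ g, 0 ≤ Q g := by
    intro g
    have hg : g ∈ closure (Submodule.span ℂ (Set.range (mFourier (d := Fin d))) : Set _) := by
      rw [← Submodule.topologicalClosure_coe, span_mFourier_closure_eq_top]
      trivial
    refine closure_minimal (t := {g | 0 ≤ Q g}) ?_ (isClosed_le continuous_const hQc) hg
    intro g hg
    obtain ⟨c, rfl⟩ := (Finsupp.mem_span_range_iff_exists_finsupp).mp hg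
    have h := integral_norm_sq_mul_eq (A := A) hf (integrable_continuousMap φ) hφ c.support c id
    refine le_of_le_of_eq ?_ (h.symm.trans ?_)
    · exact integral_nonneg fun x => by positivity
    · simp [Q, Finsupp.sum]
  by_contra hneg
  push Not at hneg
  -- Testing with the square root of the negative part `ψ` of `φ` gives `-∫ ψ² ≥ 0`.
  let ψ : C(UnitAddTorus (Fin d), ℝ) := ⟨fun t => max (-φ t) 0, by fun_prop⟩
  have h1 := hQ ⟨fun t => (Real.sqrt (ψ t) : ℂ), by fun_prop⟩
  have h2 : ∀ t, ‖(Real.sqrt (ψ t) : ℂ)‖ ^ 2 * φ t = - (ψ t ^ 2) := by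
    intro t
    have hψ : 0 ≤ ψ t := le_max_right _ _
    rw [Complex.norm_real, Real.norm_eq_abs, sq_abs, Real.sq_sqrt hψ]
    rcases le_total (φ t) 0 with h | h
    · have : ψ t = -φ t := max_eq_left (by linarith)
      rw [this]; ring
    · have : ψ t = 0 := max_eq_right (by linarith)
      rw [this]; ring
  simp only [Q, ContinuousMap.coe_mk, h2, integral_neg] at h1
  have h3 : 0 < ∫ t, ψ t ^ 2 ∂torusHaar d := by
    refine Continuous.integral_pos_of_hasCompactSupport_nonneg_nonzero (x := t) (by fun_prop)
      (HasCompactSupport.of_compactSpace _) (fun t => sq_nonneg _) ?_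
    have : ψ t = -φ t := max_eq_left (by linarith)
    simp only [this]
    exact pow_ne_zero 2 (by linarith)
  linarith

theorem IsCharSeries.exists_isSpectralDensity {κ : Type*} [Countable κ] {ch : κ → PontryaginDual G}
    {w : κ → ℂ} (hA : A.dual.IsMixing) (hf : IsCharSeries μ f ch w) :
    ∃ φ : C(UnitAddTorus (Fin d), ℝ), IsSpectralDensity A μ f φ := by
  have hs : Summable fun l => (correlation A μ f l : ℂ) • mFourier (d := Fin d) l := by
    refine Summable.of_norm ?_
    simpa [norm_smul, mFourier_norm] using hf.summable_correlation hA
  let Φ : C(UnitAddTorus (Fin d), ℂ) := ∑' l, (correlation A μ f l : ℂ) • mFourier l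
  have hΦt : ∀ t, HasSum (fun l => (correlation A μ f l : ℂ) * mFourier l t) (Φ t) := fun t =>
    ContinuousMap.hasSum_apply hs.hasSum t
  let φ : C(UnitAddTorus (Fin d), ℝ) := ⟨fun t => (Φ t).re, by fun_prop⟩
  have hφ : ∀ t, (φ t : ℂ) = Φ t := by
    intro t
    refine Complex.conj_eq_iff_re.mp ?_
    -- The sum is real because the correlation is real and even.
    have h1 := (Equiv.neg (Fin d → ℤ)).hasSum_iff.mpr (hΦt t).star
    refine h1.unique ?_
    convert! hΦt t using 2 with l
    simp [correlation_neg, mFourier_neg]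
  refine ⟨φ, ?_⟩
  have hcoef : ∀ l : Fin d → ℤ,
      ∫ t, mFourier (-l) t * (φ t : ℂ) ∂torusHaar d = correlation A μ f l := by
    intro l
    simp only [hφ]
    have hn : ∀ m t, ‖mFourier (-l) t * ((correlation A μ f m : ℂ) * mFourier m t)‖ =
        ‖correlation A μ f m‖ := fun m t => by
      rw [norm_mul, norm_mul, norm_mFourier_apply, norm_mFourier_apply, one_mul, mul_one,
        Complex.norm_real]
    have h := hasSum_integral_of_summable_integral_norm (μ := torusHaar d)
      (F := fun m t => mFourier (-l) t * ((correlation A μ f m : ℂ) * mFourier m t))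
      (fun m => integrable_continuousMap (mFourier (-l) * ((correlation A μ f m : ℂ) • mFourier m)))
      (by simpa only [hn, integral_const, probReal_univ, one_smul] using hf.summable_correlation hA)
    simp only [((hΦt _).mul_left _).tsum_eq] at h
    refine h.unique ?_
    convert! hasSum_ite_eq l (correlation A μ f l : ℂ) using 2 with m
    have : ∀ t, mFourier (-l) t * ((correlation A μ f m : ℂ) * mFourier m t) =
        (correlation A μ f m : ℂ) * mFourier (m - l) t := fun t => by
      rw [sub_eq_neg_add, mFourier_add]
      ring
    simp only [this]
    rw [integral_const_mul, integral_mFourier]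
    by_cases hml : m = l
    · simp [hml]
    · simp [hml, sub_eq_zero]
  exact isSpectralDensity_iff.mpr ⟨nonneg_of_correlation (hf.memLp 2) hcoef, hcoef⟩

end SpectralDensity

/-! ### Moments, characteristic functions and `L²` perturbation -/

section Analysis

theorem tendsto_of_uniform_approx {E : Type*} [SeminormedAddCommGroup E] {a : ℕ → E}
    {s : ℕ → ℕ → E} {e : ℕ → ℕ → ℝ} {S : ℕ → E} {e' : ℕ → ℝ} {L : E}
    (hle : ∀ J n, ‖a n - s J n‖ ≤ e J n) (hs : ∀ J, Tendsto (s J) atTop (𝓝 (S J)))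
    (he : ∀ J, Tendsto (e J) atTop (𝓝 (e' J))) (hS : Tendsto S atTop (𝓝 L))
    (he' : Tendsto e' atTop (𝓝 0)) : Tendsto a atTop (𝓝 L) := by
  rw [Metric.tendsto_atTop]
  intro ε hε
  obtain ⟨J, hJ1, hJ2⟩ := ((he'.eventually_lt_const (show (0 : ℝ) < ε / 3 by positivity)).and
    (Metric.tendsto_nhds.mp hS (ε / 3) (by positivity))).exists
  obtain ⟨N, hN⟩ := eventually_atTop.mp (((he J).eventually_lt_const hJ1).and
    (Metric.tendsto_nhds.mp (hs J) (ε / 3) (by positivity)))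
  refine ⟨N, fun n hn => ?_⟩
  obtain ⟨h1, h2⟩ := hN n hn
  have h3 := hle J n
  rw [← dist_eq_norm] at h3
  linarith [dist_triangle4 (a n) (s J n) (S J) L]

/-- Induction on `K`: the derivative of one Taylor remainder is `I` times the preceding one, so the
bound integrates. -/
theorem norm_exp_mul_I_sub_sum_le_of_nonneg (K : ℕ) {x : ℝ} (hx : 0 ≤ x) :
    ‖Complex.exp (x * Complex.I) - ∑ k ∈ Finset.range K, (x * Complex.I) ^ k / (k.factorial : ℂ)‖ ≤
      x ^ K / K.factorial := by
  induction K generalizing x with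
  | zero => simp [Complex.norm_exp_ofReal_mul_I]
  | succ K ih =>
    let F : ℝ → ℂ := fun y => Complex.exp (y * Complex.I) -
      ∑ k ∈ Finset.range (K + 1), (y * Complex.I) ^ k / (k.factorial : ℂ)
    let F' : ℝ → ℂ := fun y => (Complex.exp (y * Complex.I) -
      ∑ k ∈ Finset.range K, (y * Complex.I) ^ k / (k.factorial : ℂ)) * Complex.I
    have hlin : ∀ y : ℝ, HasDerivAt (fun y : ℝ => (y : ℂ) * Complex.I) Complex.I y := fun y => by
      simpa using (Complex.ofRealCLM.hasDerivAt (x := y)).mul_const Complex.I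
    have hF : ∀ y, HasDerivAt F (F' y) y := by
      intro y
      have h1 : HasDerivAt (fun y : ℝ => ∑ k ∈ Finset.range (K + 1),
          ((y : ℂ) * Complex.I) ^ k / (k.factorial : ℂ))
          (∑ k ∈ Finset.range (K + 1),
            ((k : ℂ) * ((y : ℂ) * Complex.I) ^ (k - 1) * Complex.I) / (k.factorial : ℂ)) y :=
        HasDerivAt.fun_sum fun k _ => ((hlin y).pow k).div_const _
      convert! (hlin y).cexp.sub h1 using 1
      rw [Finset.sum_range_succ']
      simp only [F', sub_mul, Finset.sum_mul, Nat.cast_zero, zero_mul, zero_div, add_zero]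
      congr 1
      refine Finset.sum_congr rfl fun k _ => ?_
      rw [Nat.factorial_succ, Nat.add_sub_cancel]
      have : ((k : ℂ) + 1) ≠ 0 := Nat.cast_add_one_ne_zero k
      push_cast
      field_simp
    have h := image_norm_le_of_norm_deriv_right_le_deriv_boundary (a := 0) (b := x) (f := F)
      (f' := F') (B := fun y => y ^ (K + 1) / (K + 1).factorial)
      (B' := fun y => y ^ K / K.factorial)
      (fun y _ => (hF y).continuousAt.continuousWithinAt)
      (fun y _ => (hF y).hasDerivWithinAt)
      (by
        simp [F, Finset.sum_range_succ'])
      (fun y => by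
        convert! ((hasDerivAt_id y).pow (K + 1)).div_const ((K + 1).factorial : ℝ) using 1
        rw [Nat.factorial_succ]
        push_cast
        simp only [id, mul_one]
        field_simp)
      (fun y hy => by
        simp only [F', norm_mul, Complex.norm_I, mul_one]
        exact ih hy.1)
    exact h ⟨hx, le_rfl⟩

theorem norm_exp_mul_I_sub_sum_le (K : ℕ) (x : ℝ) :
    ‖Complex.exp (x * Complex.I) - ∑ k ∈ Finset.range K, (x * Complex.I) ^ k / (k.factorial : ℂ)‖ ≤
      |x| ^ K / K.factorial := by
  rcases le_total 0 x with hx | hx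
  · rw [abs_of_nonneg hx]
    exact norm_exp_mul_I_sub_sum_le_of_nonneg K hx
  · rw [abs_of_nonpos hx]
    refine le_of_eq_of_le ?_ (norm_exp_mul_I_sub_sum_le_of_nonneg K (neg_nonneg.mpr hx))
    rw [← Complex.norm_conj]
    congr 1
    simp [← Complex.exp_conj]

theorem gaussianMoment_odd (v : ℝ) (j : ℕ) : gaussianMoment v (2 * j + 1) = 0 := by
  induction j with
  | zero => rfl
  | succ j ih =>
    rw [show 2 * (j + 1) + 1 = (2 * j + 1) + 2 by ring, gaussianMoment, ih, mul_zero]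

theorem gaussianMoment_even (v : ℝ) (j : ℕ) :
    gaussianMoment v (2 * j) / (2 * j).factorial = (v / 2) ^ j / j.factorial := by
  induction j with
  | zero => simp [gaussianMoment]
  | succ j ih =>
    rw [div_eq_iff (by positivity)] at ih
    rw [show 2 * (j + 1) = (2 * j) + 2 by ring, gaussianMoment, Nat.factorial_succ,
      Nat.factorial_succ, Nat.factorial_succ, pow_succ, ih]
    push_cast
    field_simp
    ring

theorem sum_gaussianMoment (v t : ℝ) (J : ℕ) :
    ∑ k ∈ Finset.range (2 * J), (t * Complex.I) ^ k / (k.factorial : ℂ) * (gaussianMoment v k : ℂ) =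
      ∑ j ∈ Finset.range J, (-(v * t ^ 2 / 2) : ℂ) ^ j / (j.factorial : ℂ) := by
  induction J with
  | zero => simp
  | succ J ih =>
    rw [show 2 * (J + 1) = 2 * J + 1 + 1 by ring, Finset.sum_range_succ, Finset.sum_range_succ, ih,
      gaussianMoment_odd, Complex.ofReal_zero, mul_zero, add_zero, Finset.sum_range_succ]
    congr 1
    have h := congrArg (fun x : ℝ => (x : ℂ)) (gaussianMoment_even v J)
    push_cast at h
    rw [div_mul_eq_mul_div, mul_div_assoc, h, mul_pow, pow_mul, pow_mul, Complex.I_sq,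
      ← mul_div_assoc, ← mul_pow, ← mul_pow]
    congr 2
    ring

variable {Ω : Type*} [MeasurableSpace Ω] {P : Measure Ω} [IsProbabilityMeasure P]

/-- Convergence of moments to those of a Gaussian variable implies convergence of characteristic
functions. -/
theorem tendsto_integral_exp_of_moments {X : ℕ → Ω → ℝ} {v : ℝ} (hX : ∀ n, AEMeasurable (X n) P)
    (hXi : ∀ n r, Integrable (fun x => X n x ^ r) P)
    (hm : ∀ r, Tendsto (fun n => ∫ x, X n x ^ r ∂P) atTop (𝓝 (gaussianMoment v r))) (t : ℝ) :
    Tendsto (fun n => ∫ x, Complex.exp ((t * X n x : ℝ) * Complex.I) ∂P) atTop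
      (𝓝 (Complex.exp (-(v * t ^ 2 / 2)))) := by
  -- Taylor polynomials have `2 * J` terms, so the remainder is bounded by an even power and its
  -- integral is a genuine moment. In the limit it is `(v t² / 2)^J / J!`, which tends to `0`.
  refine tendsto_of_uniform_approx
    (s := fun J n => ∑ k ∈ Finset.range (2 * J), (t * Complex.I) ^ k / (k.factorial : ℂ) *
      ((∫ x, X n x ^ k ∂P : ℝ) : ℂ))
    (e := fun J n => |t| ^ (2 * J) / (2 * J).factorial * ∫ x, X n x ^ (2 * J) ∂P)
    (S := fun J => ∑ k ∈ Finset.range (2 * J), (t * Complex.I) ^ k / (k.factorial : ℂ) *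
      (gaussianMoment v k : ℂ))
    (e' := fun J => |t| ^ (2 * J) / (2 * J).factorial * gaussianMoment v (2 * J))
    ?_ ?_ (fun J => (hm (2 * J)).const_mul _) ?_ ?_
  · intro J n
    have hexp : Integrable (fun x => Complex.exp ((t * X n x : ℝ) * Complex.I)) P :=
      Integrable.of_bound (by have := hX n; fun_prop) 1
        (Eventually.of_forall fun x => (Complex.norm_exp_ofReal_mul_I _).le)
    have hpow : ∀ k, Integrable (fun x => ((t * X n x : ℝ) * Complex.I) ^ k /
        (k.factorial : ℂ)) P := by
      intro k
      refine (((hXi n k).ofReal (𝕜 := ℂ)).const_mul ((t * Complex.I) ^ k / (k.factorial : ℂ))).congr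
        (Eventually.of_forall fun x => ?_)
      simp only [Complex.coe_algebraMap, RCLike.ofReal_pow]
      push_cast
      ring
    have hsum : ∑ k ∈ Finset.range (2 * J), (t * Complex.I) ^ k / (k.factorial : ℂ) *
        ((∫ x, X n x ^ k ∂P : ℝ) : ℂ) = ∫ x, ∑ k ∈ Finset.range (2 * J),
          ((t * X n x : ℝ) * Complex.I) ^ k / (k.factorial : ℂ) ∂P := by
      rw [integral_finsetSum _ fun k _ => hpow k]
      refine Finset.sum_congr rfl fun k _ => ?_
      rw [← integral_complex_ofReal, ← integral_const_mul]
      congr 1 with x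
      push_cast
      ring
    rw [hsum, ← integral_sub hexp (integrable_finsetSum _ fun k _ => hpow k), ← integral_const_mul]
    refine norm_integral_le_of_norm_le ((hXi n (2 * J)).const_mul _)
      (Eventually.of_forall fun x => (norm_exp_mul_I_sub_sum_le _ _).trans_eq ?_)
    rw [abs_mul, mul_pow, (even_two_mul J).pow_abs (X n x)]
    ring
  · intro J
    exact tendsto_finsetSum _ fun k _ =>
      ((Complex.continuous_ofReal.tendsto _).comp (hm k)).const_mul _
  · simp only [sum_gaussianMoment]
    rw [Complex.exp_eq_exp_ℂ]
    exact (NormedSpace.expSeries_div_hasSum_exp _).tendsto_sum_nat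
  · have h := FloorSemiring.tendsto_pow_div_factorial_atTop (v / 2 * t ^ 2)
    refine h.congr fun J => ?_
    rw [div_mul_eq_mul_div (|t| ^ (2 * J)), mul_div_assoc (|t| ^ (2 * J)), gaussianMoment_even, pow_mul,
      sq_abs, mul_pow]
    ring

theorem norm_integral_exp_sub_le {X Y : Ω → ℝ} (hX : AEMeasurable X P) (hY : AEMeasurable Y P)
    {ε : ℝ} (hε : 0 < ε) (hi : Integrable (fun x => (X x - Y x) ^ 2) P)
    (hXY : ∫ x, (X x - Y x) ^ 2 ∂P ≤ ε ^ 2) (t : ℝ) :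
    ‖∫ x, Complex.exp ((t * X x : ℝ) * Complex.I) ∂P -
      ∫ x, Complex.exp ((t * Y x : ℝ) * Complex.I) ∂P‖ ≤ |t| * ε := by
  have hexp : ∀ {Z : Ω → ℝ}, AEMeasurable Z P →
      Integrable (fun x => Complex.exp ((t * Z x : ℝ) * Complex.I)) P := fun hZ =>
    Integrable.of_bound (by fun_prop) 1
      (Eventually.of_forall fun x => (Complex.norm_exp_ofReal_mul_I _).le)
  rw [← integral_sub (hexp hX) (hexp hY)]
  -- The bound `|D| ≤ ε / 2 + D² / (2 ε)` for `D = X - Y` replaces the Cauchy–Schwarz inequality.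
  have hb : ∀ x, ‖Complex.exp ((t * X x : ℝ) * Complex.I) -
      Complex.exp ((t * Y x : ℝ) * Complex.I)‖ ≤
      |t| * (ε / 2 + (X x - Y x) ^ 2 / (2 * ε)) := by
    intro x
    have h1 : Complex.exp ((t * X x : ℝ) * Complex.I) - Complex.exp ((t * Y x : ℝ) * Complex.I) =
        Complex.exp ((t * Y x : ℝ) * Complex.I) *
          (Complex.exp (Complex.I * ((t * (X x - Y x) : ℝ) : ℂ)) - 1) := by
      rw [mul_sub, ← Complex.exp_add, mul_one]
      congr 2
      push_cast
      ring
    rw [h1, norm_mul, Complex.norm_exp_ofReal_mul_I, one_mul]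
    refine Real.norm_exp_I_mul_ofReal_sub_one_le.trans ?_
    rw [Real.norm_eq_abs, abs_mul]
    refine mul_le_mul_of_nonneg_left ?_ (abs_nonneg t)
    rw [← sq_abs, ← sub_nonneg]
    have : ε / 2 + |X x - Y x| ^ 2 / (2 * ε) - |X x - Y x| = (|X x - Y x| - ε) ^ 2 / (2 * ε) := by
      field_simp
      ring
    rw [this]
    positivity
  refine (norm_integral_le_of_norm_le (((integrable_const _).add (hi.div_const _)).const_mul _)
    (Eventually.of_forall hb)).trans ?_
  rw [integral_const_mul]
  refine mul_le_mul_of_nonneg_left ?_ (abs_nonneg t)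
  have := integral_add (integrable_const (μ := P) (ε / 2)) (hi.div_const (2 * ε))
  simp only [Pi.add_apply] at this ⊢
  rw [this, integral_const, integral_div, probReal_univ, one_smul]
  have h2 : (∫ x, (X x - Y x) ^ 2 ∂P) / (2 * ε) ≤ ε ^ 2 / (2 * ε) := by gcongr
  have h3 : ε ^ 2 / (2 * ε) = ε / 2 := by field_simp
  linarith

theorem abs_integral_sq_sub_le {X Y : Ω → ℝ} (hX : MemLp X 2 P) (hY : MemLp Y 2 P) {ε W : ℝ}
    (hε : 0 < ε) (hXW : ∫ x, X x ^ 2 ∂P ≤ W) (hXY : ∫ x, (X x - Y x) ^ 2 ∂P ≤ ε ^ 2) :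
    |∫ x, X x ^ 2 ∂P - ∫ x, Y x ^ 2 ∂P| ≤ ε * W + ε + ε ^ 2 := by
  have hD := (hX.sub hY).integrable_sq
  simp only [Pi.sub_apply] at hD
  rw [← integral_sub hX.integrable_sq hY.integrable_sq]
  -- With `D = X - Y`, one has `X² - Y² = 2 X D - D²` and `|2 X D| ≤ ε X² + D² / ε`.
  have hb : ∀ x, ‖X x ^ 2 - Y x ^ 2‖ ≤ ε * X x ^ 2 + (1 / ε + 1) * (X x - Y x) ^ 2 := by
    intro x
    rw [Real.norm_eq_abs, abs_le]
    have h1 : 0 ≤ (ε * X x + (X x - Y x)) ^ 2 / ε := by positivity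
    have h2 : 0 ≤ (ε * X x - (X x - Y x)) ^ 2 / ε := by positivity
    have h3 : (ε * X x + (X x - Y x)) ^ 2 / ε = ε * X x ^ 2 + 2 * X x * (X x - Y x) +
      1 / ε * (X x - Y x) ^ 2 := by field_simp; ring
    have h4 : (ε * X x - (X x - Y x)) ^ 2 / ε = ε * X x ^ 2 - 2 * X x * (X x - Y x) +
      1 / ε * (X x - Y x) ^ 2 := by field_simp; ring
    constructor <;> nlinarith [sq_nonneg (X x - Y x)]
  refine (norm_integral_le_of_norm_le ((hX.integrable_sq.const_mul ε).add
    (hD.const_mul (1 / ε + 1))) (Eventually.of_forall hb)).trans ?_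
  have := integral_add (hX.integrable_sq.const_mul ε) (hD.const_mul (1 / ε + 1))
  simp only [Pi.add_apply] at this ⊢
  rw [this, integral_const_mul, integral_const_mul]
  have h2 : (1 / ε + 1) * ∫ x, (X x - Y x) ^ 2 ∂P ≤ (1 / ε + 1) * ε ^ 2 := by gcongr
  have h3 : (1 / ε + 1) * ε ^ 2 = ε + ε ^ 2 := by field_simp
  have h4 : ε * ∫ x, X x ^ 2 ∂P ≤ ε * W := by gcongr
  linarith

end Analysis

/-! ### Trigonometric approximation and the limit theorem -/

section LimitTheorem

open UnitAddTorus

variable {d : ℕ} {G : Type*} [CommGroup G] [TopologicalSpace G]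
  [IsTopologicalGroup G] [CompactSpace G] [T2Space G] [MeasurableSpace G] [BorelSpace G]
  {μ : Measure G} [μ.IsHaarMeasure] [IsProbabilityMeasure μ] {A : AutAction d G} {f : G → ℝ}

theorem IsAC0.fourierCoefficient_one (hf : IsAC0 μ f) : fourierCoefficient μ f 1 = 0 := by
  simp only [fourierCoefficient, PontryaginDual.one_apply, Circle.coe_one, map_one, one_mul]
  rw [integral_complex_ofReal, hf.integral_eq_zero, Complex.ofReal_zero]

theorem IsAC0.countable_support (hf : IsAC0 μ f) :
    (Function.support (fourierCoefficient μ f)).Countable := by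
  have := hf.summable.countable_support
  rwa [show (fun χ => ‖fourierCoefficient μ f χ‖) = norm ∘ fourierCoefficient μ f from rfl,
    Function.support_comp_eq _ norm_eq_zero] at this

/-- Restricting to the support makes the index set countable and removes the trivial character,
whose coefficient is the mean of `f`. -/
theorem IsAC0.isCharSeries (hf : IsAC0 μ f) : IsCharSeries μ f
    (fun χ : Function.support (fourierCoefficient μ f) => (χ : PontryaginDual G))
    (fun χ => fourierCoefficient μ f χ) where
  nontrivial χ h := χ.2 (by rw [h, hf.fourierCoefficient_one])
  summable := hf.summable.subtype _
  aestronglyMeasurable := hf.integrable.1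
  hasSum := by
    filter_upwards [hf.hasSum] with x hx
    refine (hasSum_subtype_iff_of_support_subset (f := fun χ : PontryaginDual G =>
      fourierCoefficient μ f χ * (χ x : ℂ)) fun χ hχ => ?_).mpr hx
    exact left_ne_zero_of_mul hχ

/-- The real part of an absolutely convergent series of nontrivial characters. -/
theorem isCharSeries_re {κ : Type*} {ch : κ → PontryaginDual G} {w : κ → ℂ} {g : G → ℂ}
    (hch : ∀ a, ch a ≠ 1) (hw : Summable fun a => ‖w a‖) (hg : AEStronglyMeasurable g μ)
    (hs : ∀ᵐ x ∂μ, HasSum (fun a => w a * (ch a x : ℂ)) (g x)) :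
    IsCharSeries μ (fun x => (g x).re) (Sum.elim ch fun a => (ch a)⁻¹)
      (Sum.elim (fun a => w a / 2) fun a => (starRingEnd ℂ) (w a) / 2) where
  nontrivial := by
    rintro (a | a)
    · exact hch a
    · exact inv_ne_one.mpr (hch a)
  summable := by
    refine Summable.sum _ ?_ ?_ <;> simpa [Function.comp_def] using hw.div_const 2
  aestronglyMeasurable := Complex.continuous_re.comp_aestronglyMeasurable hg
  hasSum := by
    filter_upwards [hs] with x hx
    have h1 := hx.div_const 2
    have h2 := hx.star.div_const 2
    have h3 : (((g x).re : ℝ) : ℂ) = g x / 2 + star (g x) / 2 := by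
      rw [Complex.re_eq_add_conj]
      simp only [RCLike.star_def]
      ring
    rw [h3]
    refine HasSum.sum ?_ ?_
    · convert! h1 using 2 with a
      simp only [Function.comp_apply, Sum.elim_inl]
      ring
    · convert! h2 using 2 with a
      have : ((ch a)⁻¹ x : Circle) = (ch a x)⁻¹ := rfl
      simp only [Function.comp_apply, Sum.elim_inr, this, Circle.coe_inv_eq_conj, RCLike.star_def,
        map_mul]
      ring

theorem tsum_norm_sumElim {κ : Type*} {w : κ → ℂ} (hw : Summable fun a => ‖w a‖) :
    ∑' a, ‖Sum.elim (fun a => w a / 2) (fun a => (starRingEnd ℂ) (w a) / 2) a‖ = ∑' a, ‖w a‖ := by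
  have h : Summable fun a => ‖w a‖ / 2 := hw.div_const 2
  rw [Summable.tsum_sum]
  · simp only [Sum.elim_inl, Sum.elim_inr, norm_div, RCLike.norm_conj, Complex.norm_ofNat]
    rw [tsum_div_const]
    ring
  · simpa [Function.comp_def] using h
  · simpa [Function.comp_def] using h

/-- Approximation by real trigonometric polynomials. -/
theorem IsCharSeries.exists_finite_approx {κ : Type*} {ch : κ → PontryaginDual G} {w : κ → ℂ}
    (hf : IsCharSeries μ f ch w) {ε : ℝ} (hε : 0 < ε) :
    ∃ (S : Finset κ) (q : G → ℝ) (w' : S ⊕ S → ℂ)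
      (w'' : {a // a ∉ S} ⊕ {a // a ∉ S} → ℂ),
      IsCharSeries μ q (Sum.elim (fun a : S => ch a) fun a : S => (ch a)⁻¹) w' ∧
      IsCharSeries μ (fun x => f x - q x)
        (Sum.elim (fun a : {a // a ∉ S} => ch a) fun a : {a // a ∉ S} => (ch a)⁻¹) w'' ∧
      ∑' a, ‖w'' a‖ < ε := by
  classical
  obtain ⟨S, hS⟩ := ((tendsto_order.mp (tendsto_tsum_compl_atTop_zero fun a => ‖w a‖)).2 ε hε).exists
  -- A partial sum need not be real, so its real part is used. The inverse characters then appear,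
  -- possibly with repetitions, and the sum of the norms of the coefficients does not change.
  let g : G → ℂ := fun x => ∑ a ∈ S, w a * (ch a x : ℂ)
  have hg : AEStronglyMeasurable g μ := Continuous.aestronglyMeasurable
    (continuous_finsetSum _ fun a _ => (continuous_character _).const_mul _)
  have hgs : ∀ x, HasSum (fun a : S => w a * (ch a x : ℂ)) (g x) := fun x =>
    S.hasSum (fun a => w a * (ch a x : ℂ))
  have hsub : Summable fun a : {a // a ∉ S} => ‖w a‖ := hf.summable.subtype _
  have h1 := isCharSeries_re (μ := μ) (ch := fun a : S => ch a) (w := fun a : S => w a)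
    (fun a => hf.nontrivial a) (hf.summable.subtype _) hg (Eventually.of_forall hgs)
  have h2 := isCharSeries_re (μ := μ) (ch := fun a : {a // a ∉ S} => ch a)
    (w := fun a : {a // a ∉ S} => w a) (g := fun x => (f x : ℂ) - g x)
    (fun a => hf.nontrivial a) hsub
    ((Complex.continuous_ofReal.comp_aestronglyMeasurable hf.aestronglyMeasurable).sub hg) (by
      filter_upwards [hf.hasSum] with x hx
      have := (S.hasSum_compl_iff (f := fun a => w a * (ch a x : ℂ)) (a := (f x : ℂ) - g x)).mpr
        (by simpa [g] using hx)
      exact this)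
  refine ⟨S, _, _, _, h1, by simpa using h2, ?_⟩
  rw [tsum_norm_sumElim hsub]
  exact hS

/-- Expanding the power gives products of translated characters, and only the trivial products have
nonzero integral. -/
theorem integral_birkhoff_pow {κ : Type*} [Fintype κ] {ch : κ → PontryaginDual G} {w : κ → ℂ}
    (hf : IsCharSeries μ f ch w) (z : ℕ → Fin d → ℤ) (n r : ℕ) :
    ((∫ x, birkhoff A z f n x ^ r ∂μ : ℝ) : ℂ) = momentSum A.dual z ch w n r := by
  classical
  have hae : ∀ᵐ x ∂μ, ∀ k, HasSum (fun a => w a * (ch a (A (z k) x) : ℂ)) (f (A (z k) x) : ℂ) :=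
    ae_all_iff.mpr fun k => (A.measurePreserving μ (z k)).quasiMeasurePreserving.ae hf.hasSum
  have hpt : ∀ᵐ x ∂μ, ((birkhoff A z f n x ^ r : ℝ) : ℂ) = ∑ p : Fin r → Fin n × κ,
      (∏ i, w (p i).2) * ((∏ i, translate A.dual z ch (p i)) x : ℂ) := by
    filter_upwards [hae] with x hx
    have h1 : (birkhoff A z f n x : ℂ) =
        ∑ q : Fin n × κ, w q.2 * (translate A.dual z ch q x : ℂ) := by
      rw [Fintype.sum_prod_type, birkhoff, Complex.ofReal_sum,
        ← Fin.sum_univ_eq_sum_range (fun k => (f (A (z k) x) : ℂ))]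
      refine Finset.sum_congr rfl fun k _ => ?_
      exact (hx k).unique (hasSum_fintype _)
    rw [Complex.ofReal_pow, h1, Fintype.sum_pow]
    refine Finset.sum_congr rfl fun p _ => ?_
    rw [Finset.prod_mul_distrib, prod_dual_apply]
    congr 1
    exact (map_prod Circle.coeHom _ _).symm
  rw [← integral_complex_ofReal, integral_congr_ae hpt, integral_finsetSum, momentSum]
  · refine Finset.sum_congr rfl fun p _ => ?_
    rw [integral_const_mul, integral_character]
    split_ifs <;> simp
  · intro p _
    refine Integrable.const_mul ?_ _
    exact Integrable.of_bound (continuous_character _).aestronglyMeasurable 1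
      (Eventually.of_forall fun x => (Circle.norm_coe _).le)

/-- The normalized sum of `f` along the first `n` points of `z`. -/
def normalizedSum (A : AutAction d G) (z : ℕ → Fin d → ℤ) (f : G → ℝ) (n : ℕ) (x : G) : ℝ :=
  (selfIntersections z n : ℝ) ^ (-(1 / 2) : ℝ) * birkhoff A z f n x

theorem selfIntersections_rpow_neg_half_pow (z : ℕ → Fin d → ℤ) (n r : ℕ) :
    ((selfIntersections z n : ℝ) ^ (-(1 / 2) : ℝ)) ^ r =
      ((selfIntersections z n : ℝ) ^ ((r : ℝ) / 2))⁻¹ := by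
  rw [← Real.rpow_natCast, ← Real.rpow_mul (by positivity), ← Real.rpow_neg (by positivity)]
  congr 1
  ring

theorem memLp_normalizedSum {p : ENNReal} (hf : MemLp f p μ) (z : ℕ → Fin d → ℤ) (n : ℕ) :
    MemLp (normalizedSum A z f n) p μ :=
  (memLp_birkhoff hf z n).const_mul _

theorem integral_normalizedSum_pow (z : ℕ → Fin d → ℤ) (n r : ℕ) :
    ∫ x, normalizedSum A z f n x ^ r ∂μ =
      (∫ x, birkhoff A z f n x ^ r ∂μ) / (selfIntersections z n : ℝ) ^ ((r : ℝ) / 2) := by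
  simp only [normalizedSum, mul_pow, selfIntersections_rpow_neg_half_pow]
  rw [integral_const_mul, inv_mul_eq_div]

theorem integral_normalizedSum_sq_le {κ : Type*} [Countable κ] {ch : κ → PontryaginDual G}
    {w : κ → ℂ} (hA : A.dual.IsMixing) (hf : IsCharSeries μ f ch w) (z : ℕ → Fin d → ℤ) (n : ℕ) :
    ∫ x, normalizedSum A z f n x ^ 2 ∂μ ≤ (∑' a, ‖w a‖) ^ 2 := by
  rw [integral_normalizedSum_pow, Nat.cast_ofNat, div_self two_ne_zero, Real.rpow_one]
  exact div_le_of_le_mul₀ (by positivity) (by positivity)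
    ((integral_birkhoff_sq_le hA hf z n).trans_eq (mul_comm _ _))

theorem tendsto_integral_normalizedSum_sq (hf : MemLp f 2 μ) {φ : C(UnitAddTorus (Fin d), ℝ)}
    (hφ : IsSpectralDensity A μ f φ) {z : ℕ → Fin d → ℤ} {ζ : Measure (UnitAddTorus (Fin d))}
    (hζ : IsZetaRegular (sequentialSummation z) ζ) :
    Tendsto (fun n => ∫ x, normalizedSum A z f n x ^ 2 ∂μ) atTop (𝓝 (∫ t, φ t ∂ζ)) := by
  refine (hζ φ).congr fun n => ?_
  rw [integral_normalizedSum_pow, Nat.cast_ofNat, div_self two_ne_zero, Real.rpow_one,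
    integral_birkhoff_sq_eq hf (isSpectralDensity_iff.mp hφ).2]

theorem tendsto_charFun_of_finite {κ : Type*} [Fintype κ] {ch : κ → PontryaginDual G}
    {w : κ → ℂ} (hA : A.dual.IsMixing) (hf : IsCharSeries μ f ch w) {z : ℕ → Fin d → ℤ}
    (hz : HasSmallLocalTimes z) {v : ℝ}
    (hv : Tendsto (fun n => ∫ x, normalizedSum A z f n x ^ 2 ∂μ) atTop (𝓝 v)) (t : ℝ) :
    Tendsto (fun n => ∫ x, Complex.exp ((t * normalizedSum A z f n x : ℝ) * Complex.I) ∂μ) atTop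
      (𝓝 (Complex.exp (-(v * t ^ 2 / 2)))) := by
  have hm : ∀ n r, ((∫ x, normalizedSum A z f n x ^ r ∂μ : ℝ) : ℂ) = momentSum A.dual z ch w n r /
      ((selfIntersections z n : ℝ) ^ ((r : ℝ) / 2) : ℝ) := fun n r => by
    rw [integral_normalizedSum_pow, Complex.ofReal_div, integral_birkhoff_pow hf]
  refine tendsto_integral_exp_of_moments
    (fun n => (memLp_normalizedSum (hf.memLp 2) z n).aestronglyMeasurable.aemeasurable)
    (fun n r => ?_) (fun r => ?_) t
  · rcases Nat.eq_zero_or_pos r with rfl | hr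
    · simp
    · have h := memLp_normalizedSum (A := A) (hf.memLp r) z n
      refine (integrable_norm_iff (h.aestronglyMeasurable.pow r)).mp ?_
      simpa only [Pi.pow_apply, norm_pow] using h.integrable_norm_pow hr.ne'
  · have h2 : Tendsto (fun n => momentSum A.dual z ch w n 2 / (selfIntersections z n : ℝ)) atTop
        (𝓝 (v : ℂ)) := by
      refine ((Complex.continuous_ofReal.tendsto v).comp hv).congr fun n => ?_
      rw [Function.comp_apply, hm, Nat.cast_ofNat, div_self two_ne_zero, Real.rpow_one]
    have h := hz.tendsto_momentSum w hA hf.nontrivial h2 r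
    simp only [← hm] at h
    exact_mod_cast (Complex.continuous_re.tendsto _).comp h

theorem normalizedSum_sub (z : ℕ → Fin d → ℤ) (f g : G → ℝ) (n : ℕ) (x : G) :
    normalizedSum A z f n x - normalizedSum A z g n x =
      normalizedSum A z (fun x => f x - g x) n x := by
  simp only [normalizedSum, birkhoff, Finset.sum_sub_distrib, mul_sub]

theorem tendsto_charFun {κ : Type*} [Countable κ] {ch : κ → PontryaginDual G}
    {w : κ → ℂ} (hA : A.dual.IsMixing) (hf : IsCharSeries μ f ch w) {z : ℕ → Fin d → ℤ}
    (hz : HasSmallLocalTimes z) {ζ : Measure (UnitAddTorus (Fin d))}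
    (hζ : IsZetaRegular (sequentialSummation z) ζ) {φ : C(UnitAddTorus (Fin d), ℝ)}
    (hφ : IsSpectralDensity A μ f φ) (t : ℝ) :
    Tendsto (fun n => ∫ x, Complex.exp ((t * normalizedSum A z f n x : ℝ) * Complex.I) ∂μ) atTop
      (𝓝 (Complex.exp (-((∫ t, φ t ∂ζ : ℝ) * t ^ 2 / 2)))) := by
  let ε : ℕ → ℝ := fun J => 1 / ((J : ℝ) + 1)
  have hε : ∀ J, 0 < ε J := fun J => by positivity
  have hε0 : Tendsto ε atTop (𝓝 0) := tendsto_one_div_add_atTop_nhds_zero_nat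
  choose S q w' w'' hq hr hW using fun J => hf.exists_finite_approx (hε J)
  choose ψ hψ using fun J => (hq J).exists_isSpectralDensity hA
  have hlim := fun J => tendsto_integral_normalizedSum_sq ((hq J).memLp 2) (hψ J) hζ
  have hlimf := tendsto_integral_normalizedSum_sq (hf.memLp 2) hφ hζ
  have hdiff : ∀ J n, ∫ x, (normalizedSum A z f n x - normalizedSum A z (q J) n x) ^ 2 ∂μ ≤
      ε J ^ 2 := fun J n => by
    simp only [normalizedSum_sub]
    exact (integral_normalizedSum_sq_le hA (hr J) z n).trans
      (pow_le_pow_left₀ (tsum_nonneg fun _ => norm_nonneg _) (hW J).le 2)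
  -- Both integrals are limits in `n` of second moments, so the `L²` estimate that is uniform in `n`
  -- compares them without comparing the densities themselves.
  have hvar : Tendsto (fun J => ∫ t, ψ J t ∂ζ) atTop (𝓝 (∫ t, φ t ∂ζ)) := by
    rw [tendsto_iff_dist_tendsto_zero]
    refine squeeze_zero (fun _ => dist_nonneg)
      (g := fun J => ε J * (∑' a, ‖w a‖) ^ 2 + ε J + ε J ^ 2) (fun J => ?_) ?_
    · rw [dist_comm]
      refine le_of_tendsto (hlimf.dist (hlim J)) (Eventually.of_forall fun n => ?_)
      exact abs_integral_sq_sub_le (memLp_normalizedSum (hf.memLp 2) z n)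
        (memLp_normalizedSum ((hq J).memLp 2) z n) (hε J)
        (integral_normalizedSum_sq_le hA hf z n) (hdiff J n)
    · simpa using ((hε0.mul_const _).add hε0).add (hε0.pow 2)
  refine tendsto_of_uniform_approx
    (s := fun J n => ∫ x, Complex.exp ((t * normalizedSum A z (q J) n x : ℝ) * Complex.I) ∂μ)
    (e := fun J _ => |t| * ε J) (e' := fun J => |t| * ε J)
    (S := fun J => Complex.exp (-((∫ t, ψ J t ∂ζ : ℝ) * t ^ 2 / 2)))
    (fun J n => ?_) (fun J => ?_) (fun J => tendsto_const_nhds) ?_ ?_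
  · refine norm_integral_exp_sub_le
      (memLp_normalizedSum (hf.memLp 2) z n).aestronglyMeasurable.aemeasurable
      (memLp_normalizedSum ((hq J).memLp 2) z n).aestronglyMeasurable.aemeasurable (hε J) ?_
      (hdiff J n) t
    have := ((memLp_normalizedSum (A := A) (hf.memLp 2) z n).sub
      (memLp_normalizedSum (A := A) ((hq J).memLp 2) z n)).integrable_sq
    simpa using this
  · exact tendsto_charFun_of_finite hA (hq J) hz (hlim J) t
  · have hc : Continuous fun v : ℝ => Complex.exp (-((v : ℂ) * t ^ 2 / 2)) := by fun_prop
    exact (hc.tendsto _).comp hvar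
  · simpa using hε0.const_mul |t|

theorem tendstoInDistribution_normalizedSum {κ : Type*} [Countable κ] {ch : κ → PontryaginDual G}
    {w : κ → ℂ} (hA : A.dual.IsMixing) (hf : IsCharSeries μ f ch w) {z : ℕ → Fin d → ℤ}
    (hz : HasSmallLocalTimes z) {ζ : Measure (UnitAddTorus (Fin d))}
    (hζ : IsZetaRegular (sequentialSummation z) ζ) {φ : C(UnitAddTorus (Fin d), ℝ)}
    (hφ : IsSpectralDensity A μ f φ) :
    TendstoInDistribution (normalizedSum A z f) atTop (id : ℝ → ℝ) (fun _ => μ)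
      (gaussianReal 0 (Real.toNNReal (∫ t, φ t ∂ζ))) where
  forall_aemeasurable n :=
    (memLp_normalizedSum (hf.memLp 2) z n).aestronglyMeasurable.aemeasurable
  tendsto := by
    refine ProbabilityMeasure.tendsto_iff_tendsto_charFun.2 fun t => ?_
    have hv : 0 ≤ ∫ t, φ t ∂ζ := integral_nonneg hφ.1
    have h := tendsto_charFun hA hf hz hζ hφ t
    simp only [ProbabilityMeasure.coe_mk, Measure.map_id, charFun_gaussianReal,
      Real.coe_toNNReal _ hv]
    convert! h using 2 with n
    · rw [charFun_apply_real, integral_map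
        (memLp_normalizedSum (hf.memLp 2) z n).aestronglyMeasurable.aemeasurable (by fun_prop)]
      simp
    · simp

end LimitTheorem

end AlgActionCLT

end

theorem mainTheorem11 {d : ℕ} {G : Type*} [CommGroup G] [TopologicalSpace G]
    [IsTopologicalGroup G] [CompactSpace G] [T2Space G] [MeasurableSpace G] [BorelSpace G]
    (μ : Measure G) [μ.IsHaarMeasure] [IsProbabilityMeasure μ]
    (A : AlgActionCLT.AutAction d G) (hA : AlgActionCLT.IsMixingOfAllOrders A μ)
    (f : G → ℝ) (hf : AlgActionCLT.IsAC0 μ f)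
    (z : ℕ → Fin d → ℤ)
    (ζ : Measure (UnitAddTorus (Fin d))) [IsProbabilityMeasure ζ]
    (hζ : AlgActionCLT.IsZetaRegular (AlgActionCLT.sequentialSummation z) ζ)
    (hz : ∀ r : ℕ, 3 ≤ r →
      (fun n : ℕ => (n : ℝ) * (AlgActionCLT.maxLocalTime z n : ℝ) ^ (r - 1)) =o[atTop]
        (fun n : ℕ => (AlgActionCLT.selfIntersections z n : ℝ) ^ ((r : ℝ) / 2))) :
    (∃ φ : C(UnitAddTorus (Fin d), ℝ), AlgActionCLT.IsSpectralDensity A μ f φ) ∧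
      ∀ φ : C(UnitAddTorus (Fin d), ℝ), AlgActionCLT.IsSpectralDensity A μ f φ →
        TendstoInDistribution
          (fun (n : ℕ) (x : G) =>
            (AlgActionCLT.selfIntersections z n : ℝ) ^ (-(1 / 2) : ℝ) *
              ∑ k ∈ Finset.range n, f (A (z k) x))
          atTop (id : ℝ → ℝ) (fun _ => μ)
          (gaussianReal 0 (Real.toNNReal (∫ t, φ t ∂ζ))) := by
  have hT := hA.isMixing_dual μ
  have := hf.countable_support.to_subtype
  exact ⟨hf.isCharSeries.exists_isSpectralDensity hT, fun φ hφ =>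
    AlgActionCLT.tendstoInDistribution_normalizedSum hT hf.isCharSeries hz hζ hφ⟩
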